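/- Let $\ell,n\ge 0$ and $m\ge 1$ be integers, let $\mathbb S^n$ be the space of real symmetric $n\times n$ matrices, and give all matrix spaces the Frobenius inner product $\langle X,Y\rangle=\operatorname{tr}(X^TY)$ and $\mathbb E:=\mathbb R^{n\times m}\times\mathbb S^n$ the sum inner product. For a set $S$ let $\sigma_S(x)=\sup_{v\in S}\langle v,x\rangle$ be its support function, $\delta_S$ its indicator function ($0$ on $S$, $+\infty$ off $S$), $S^\circ=\{v:\langle v,x\rangle\le 1\ \forall x\in S\}$ its polar, $\operatorname{pos}S=\{\lambda x: x\in S,\lambda\ge 0\}$, $\operatorname{bar}S=\{x:\sigma_S(x)<+\infty\}$ and $S^\infty=\{v:\exists\,\lambda_k\downarrow 0,\ x_k\in S,\ \lambda_kx_k\to v\}$; for an extended-real-valued function $f$ let $\operatorname{dom}f=\{x:f(x)<+\infty\}$ and let $f^*(y)=\sup_x\{\langle x,y\rangle-f(x)\}$ be its conjugate; $\operatorname{ri}$ is the relative interior. Let $A\in\mathbb R^{\ell\times n}$ and $B\in\mathbb R^{\ell\times m}$ with $\operatorname{rge}B\subset\operatorname{rge}A$, let $\mathcal V\subset\mathbb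 S^n$ be nonempty, closed and convex, and put $h=\sigma_{\mathcal V}$. Define $$\varphi(X,V)=\sup\{\langle Y,X\rangle-\tfrac12\langle YY^T,V\rangle : Y\in\mathbb R^{n\times m},\ AY=B\},\qquad p(X)=\inf_{V\in\mathbb S^n}\{\varphi(X,V)+h(V)\},$$ $$\mathcal K_A=\{V\in\mathbb S^n: u^TVu\ge 0\ \ \forall u\in\ker A\},\qquad \Omega(A,B)=\{(Y,W)\in\mathbb E: AY=B,\ \tfrac12YY^T+W\in\mathcal K_A^\circ\},$$ $$\Omega_2(A,B)=\{W:\exists Y,\ (Y,W)\in\Omega(A,B)\},\qquad \Sigma=\Omega(A,B)+\{0\}\times\mathcal V,$$ $$\Xi(A,B)=\{Y\in\mathbb R^{n\times m}: AY=B,\ \tfrac12YY^T\in\operatorname{dom}h^*+\mathcal K_A^\circ\}.$$ Consider PCQ: $0\in\operatorname{ri}(\Omega_2(A,B)+\operatorname{dom}h^*)$, and CCQ: $\operatorname{ri}(\operatorname{dom}h)\cap\operatorname{int}\mathcal K_A\ne\emptyset$, and the conditions \begin{align*} (1a)&\ \operatorname{bar}\mathcal V\cap\operatorname{int}\mathcal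 K_A\neq\emptyset, \quad (1b)\ \mathcal V^\infty\cap(-\mathcal K_A^\circ)=\{0\},\quad (1c)\ \operatorname{cl}(\operatorname{bar}\mathcal V)-\mathcal K_A=\mathbb S^n,\\ (1d)&\ \Xi(A,B)\ne\emptyset,\\ (P)&\ \operatorname{pos}(\Omega_2(A,B)+\mathcal V)=\operatorname{span}(\Omega_2(A,B)+\mathcal V),\\ (2a)&\ \operatorname{bar}\mathcal V\cap\mathcal K_A\ne\emptyset\text{ and }\operatorname{cl}(\operatorname{bar}\mathcal V)\cap\mathcal K_A=\{0\},\\ (2b)&\ \operatorname{bar}\mathcal V\cap\mathcal K_A\text{ is nonempty and bounded},\\ (2c)&\ \operatorname{bar}\mathcal V\cap\mathcal K_A\ne\emptyset\text{ and }\mathcal V^\infty+\mathcal K_A^\circ=\mathbb S^n. \end{align*} Then $\Xi(A,B)=\{Y:(Y,0)\in\Sigma\}$, and the following hold. (a) If any one of PCQ, (P), (2a), (2b), (2c) holds, then $p$ is closed, proper and convex, and $p=p^{**}$. The same is true, and $p$ is moreover finite-valued, if any one of CCQ, (1a), (1b), (1c) holds and, in addition, (1d), PCQ or (P) holds. (b)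 $p^*=\delta_{\operatorname{cl}\Sigma}(\cdot,0)$. If any one of CCQ, (1a), (1b), (1c) holds, then $\Sigma$ is closed and $p^*=\delta_{\Xi(A,B)}$. (c) If any one of CCQ, (1a), (1b), (1c) holds, then either $p\equiv-\infty$, or $p=\sigma_{\Xi(A,B)}$ and $p$ is finite-valued; the latter is the case if and only if (1d) holds. Moreover (1d) holds whenever PCQ or (P) holds. -/

import Mathlib

open scoped Pointwise Matrix Topology

noncomputable section

/-! Tools from convex analysis.  A Euclidean space is given by a real vector space `E` with its
(standard) topology and its inner product `ip : E → E → ℝ`. -/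

section ConvexAnalysis

variable {E : Type*}

/-- The (effective) domain of an extended real valued function. -/
def effDomain (f : E → EReal) : Set E := {x | f x < ⊤}

/-- The epigraph of an extended real valued function. -/
def epi (f : E → EReal) : Set (E × ℝ) := {q | f q.1 ≤ (q.2 : EReal)}

/-- Proper: never `-∞`, and not identically `+∞`. -/
def IsProperFn (f : E → EReal) : Prop := (∀ x, f x ≠ ⊥) ∧ (effDomain f).Nonempty

/-- The class of closed, proper, convex functions. -/
def IsClosedProperConvex [AddCommGroup E] [Module ℝ E] [TopologicalSpace E]
    (f : E → EReal) : Prop :=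
  IsProperFn f ∧ Convex ℝ (epi f) ∧ IsClosed (epi f)

/-- Finite-valued: the values are real numbers. -/
def IsFiniteValued (f : E → EReal) : Prop := ∀ x, f x ≠ ⊥ ∧ f x ≠ ⊤

/-- The Fenchel conjugate. -/
def fenchelConj (ip : E → E → ℝ) (f : E → EReal) (y : E) : EReal :=
  ⨆ x : E, ((ip x y : ℝ) : EReal) - f x

/-- The support function of a set. -/
def supportFn (ip : E → E → ℝ) (S : Set E) (x : E) : EReal :=
  ⨆ v ∈ S, ((ip v x : ℝ) : EReal)

open Classical in
/-- The indicator function of a set, in the sense of convex analysis. -/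
def indicatorFn (S : Set E) (x : E) : EReal := if x ∈ S then 0 else ⊤

/-- The polar set. -/
def polarSet (ip : E → E → ℝ) (S : Set E) : Set E := {v | ∀ x ∈ S, ip v x ≤ 1}

/-- The barrier cone: the domain of the support function. -/
def barrierCone (ip : E → E → ℝ) (C : Set E) : Set E := effDomain (supportFn ip C)

/-- The horizon cone: limits of `t k • x k` with `x k ∈ S` and `t k` positive, tending to `0`. -/
def horizonCone [AddCommGroup E] [Module ℝ E] [TopologicalSpace E] (S : Set E) : Set E :=
  {v | ∃ (t : ℕ → ℝ) (x : ℕ → E), (∀ k, 0 < t k) ∧ (∀ k, x k ∈ S) ∧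
    Filter.Tendsto t Filter.atTop (𝓝 0) ∧
    Filter.Tendsto (fun k => t k • x k) Filter.atTop (𝓝 v)}

/-- The conical hull `pos S` (not convexified). -/
def posHull [AddCommGroup E] [Module ℝ E] (S : Set E) : Set E :=
  {y | ∃ t : ℝ, 0 ≤ t ∧ ∃ x ∈ S, y = t • x}

/-- Boundedness with respect to the norm induced by the inner product. -/
def IsNormBounded (ip : E → E → ℝ) (S : Set E) : Prop := ∃ c : ℝ, ∀ x ∈ S, √(ip x x) ≤ c

end ConvexAnalysis

/-! Matrix spaces, with the Frobenius inner product. -/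

/-- The Frobenius inner product `tr (Xᵀ Y)`. -/
def frob {n m : ℕ} (X Y : Matrix (Fin n) (Fin m) ℝ) : ℝ := (Xᵀ * Y).trace

/-- The space of real symmetric `n × n` matrices. -/
def SymMat (n : ℕ) : Submodule ℝ (Matrix (Fin n) (Fin n) ℝ) where
  carrier := {W | W.IsSymm}
  add_mem' := fun ha hb => Matrix.IsSymm.add ha hb
  zero_mem' := Matrix.isSymm_zero
  smul_mem' := fun c _ h => Matrix.IsSymm.smul h c

/-- The Frobenius inner product on symmetric matrices. -/
def frobSym {n : ℕ} (V W : SymMat n) : ℝ :=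
  frob (V : Matrix (Fin n) (Fin n) ℝ) (W : Matrix (Fin n) (Fin n) ℝ)

/-- The space of pairs `(Y, W)`, `Y` an `n × m` matrix and `W` symmetric of order `n`. -/
abbrev PairSpace (n m : ℕ) : Type := Matrix (Fin n) (Fin m) ℝ × SymMat n

/-- The inner product on pairs. -/
def frobPair {n m : ℕ} (P Q : PairSpace n m) : ℝ := frob P.1 Q.1 + frobSym P.2 Q.2

/-- The symmetric matrix `(1/2) Y Yᵀ`. -/
def halfGram {n m : ℕ} (Y : Matrix (Fin n) (Fin m) ℝ) : SymMat n :=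
  ⟨(1 / 2 : ℝ) • (Y * Yᵀ), by
    change ((1 / 2 : ℝ) • (Y * Yᵀ))ᵀ = (1 / 2 : ℝ) • (Y * Yᵀ)
    rw [Matrix.transpose_smul, Matrix.transpose_mul, Matrix.transpose_transpose]⟩

/-! The generalized matrix-fractional function and its infimal projections. -/

section GMF

variable {l n m : ℕ}

/-- `𝒟(A,B)`: the graph of `Y ↦ -(1/2) Y Yᵀ` over `{Y | A Y = B}`. -/
def graphD (A : Matrix (Fin l) (Fin n) ℝ) (B : Matrix (Fin l) (Fin m) ℝ) :
    Set (PairSpace n m) :=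
  {P | A * P.1 = B ∧ P.2 = -halfGram P.1}

/-- The generalized matrix-fractional function `φ`. -/
def gmf (A : Matrix (Fin l) (Fin n) ℝ) (B : Matrix (Fin l) (Fin m) ℝ) :
    PairSpace n m → EReal :=
  supportFn frobPair (graphD A B)

/-- `𝒦_A`: the symmetric matrices that are positive semidefinite on `ker A`. -/
def coneK (A : Matrix (Fin l) (Fin n) ℝ) : Set (SymMat n) :=
  {V | ∀ u : Fin n → ℝ, A *ᵥ u = 0 → 0 ≤ u ⬝ᵥ ((V : Matrix (Fin n) (Fin n) ℝ) *ᵥ u)}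

/-- `Ω(A,B)`. -/
def setOmega (A : Matrix (Fin l) (Fin n) ℝ) (B : Matrix (Fin l) (Fin m) ℝ) :
    Set (PairSpace n m) :=
  {P | A * P.1 = B ∧ halfGram P.1 + P.2 ∈ polarSet frobSym (coneK A)}

/-- `Ω₂(A,B)`: the projection of `Ω(A,B)` to the second component. -/
def setOmega₂ (A : Matrix (Fin l) (Fin n) ℝ) (B : Matrix (Fin l) (Fin m) ℝ) :
    Set (SymMat n) :=
  {W | ∃ Y : Matrix (Fin n) (Fin m) ℝ, (Y, W) ∈ setOmega A B}

/-- The infimal projection `p(X) = inf_V φ(X,V) + h(V)`. -/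
def infProj (A : Matrix (Fin l) (Fin n) ℝ) (B : Matrix (Fin l) (Fin m) ℝ)
    (h : SymMat n → EReal) (X : Matrix (Fin n) (Fin m) ℝ) : EReal :=
  ⨅ V : SymMat n, gmf A B (X, V) + h V

/-- The primal constraint qualification. -/
def PCQ (A : Matrix (Fin l) (Fin n) ℝ) (B : Matrix (Fin l) (Fin m) ℝ)
    (h : SymMat n → EReal) : Prop :=
  (0 : SymMat n) ∈ intrinsicInterior ℝ (setOmega₂ A B + effDomain (fenchelConj frobSym h))

/-- The conjugate constraint qualification. -/
def CCQ (A : Matrix (Fin l) (Fin n) ℝ) (h : SymMat n → EReal) : Prop :=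
  (intrinsicInterior ℝ (effDomain h) ∩ interior (coneK A)).Nonempty

/-- `Ξ(A,B) = {Y | A Y = B, (1/2) Y Yᵀ ∈ dom h* + 𝒦_A°}`. -/
def setXi (A : Matrix (Fin l) (Fin n) ℝ) (B : Matrix (Fin l) (Fin m) ℝ)
    (h : SymMat n → EReal) : Set (Matrix (Fin n) (Fin m) ℝ) :=
  {Y | A * Y = B ∧
    halfGram Y ∈ effDomain (fenchelConj frobSym h) + polarSet frobSym (coneK A)}

/-- `Σ = Ω(A,B) + {0} × 𝒱`. -/
def setSigma (A : Matrix (Fin l) (Fin n) ℝ) (B : Matrix (Fin l) (Fin m) ℝ)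
    (𝒱 : Set (SymMat n)) : Set (PairSpace n m) :=
  setOmega A B + ({0} : Set (Matrix (Fin n) (Fin m) ℝ)) ×ˢ 𝒱

end GMF

end

/-! Everything reduces to one convex set. Replacing the graph of `Y ↦ -½YYᵀ` by Ω does not change
the support function: for `V` in the cone 𝒦_A the extra points pair no better, and for `V` outside
it both suprema are infinite (`gmf_eq_supportFn_setOmega`). So φ + h is the support function of Σ,
and `p` is its infimal projection onto the first variable (`infProj_eq_infSupp`). The section of Σ
over `W = 0` is Ξ, and conjugation gives `p* = δ_{cl Σ}(·, 0)` (`fenchelConj_infSupp`).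

Weak duality is σ_Ξ ≤ p. Equality is obtained in two ways. If 0 is internal to the projection of Σ,
as PCQ and (P) both guarantee, proper separation supplies a multiplier `V`
(`infSupp_eq_supportFn_of_internal`). If Σ is closed and `p` is finite, then `p` is sublinear, and a
Hahn–Banach subgradient at any point must lie in Ξ by the conjugate formula
(`infSupp_eq_supportFn_of_finite`).

CCQ and (1a)–(1c) each imply `𝒱^∞ ∩ (-𝒦_A°) ⊆ {0}`. This closes Σ, and by separation it returns a
point of `bar 𝒱 ∩ int 𝒦_A`, where the quadratic form is coercive on ker A; hence `p < +∞`
everywhere. A sublinear function with no value `+∞` is either finite or identically `-∞`, which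
gives the dichotomy. Under (2a)–(2c) only `V = 0` is feasible, so `p` is the support function of the
affine set `AY = B`. In each case asserted to be closed, proper and convex, `p` is thus the support
function of a nonempty convex set, and those properties and `p = p**` follow. -/

/-! ### Abstract inner products and comparison of extended reals. -/

/-- A symmetric, positive definite bilinear form on a real vector space. -/
structure IsInnerProduct {E : Type*} [AddCommGroup E] [Module ℝ E] (ip : E → E → ℝ) : Prop where
  add_left : ∀ x y z, ip (x + y) z = ip x z + ip y z
  smul_left : ∀ (c : ℝ) x z, ip (c • x) z = c * ip x z
  symm : ∀ x y, ip x y = ip y x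
  pos : ∀ x, x ≠ 0 → 0 < ip x x

/-- Comparing extended reals through their real upper bounds turns identities between suprema into
real inequalities, away from arithmetic with infinities. -/
theorem EReal.eq_of_forall_le_coe_iff {a b : EReal} (h : ∀ r : ℝ, a ≤ r ↔ b ≤ r) : a = b := by
  refine le_antisymm ?_ ?_
  · refine EReal.le_of_forall_lt_iff_le.1 fun z hz => (h z).2 hz.le
  · refine EReal.le_of_forall_lt_iff_le.1 fun z hz => (h z).1 hz.le

theorem EReal.coe_sub_le_coe_iff (a r : ℝ) (z : EReal) :
    (a : EReal) - z ≤ r ↔ ((a - r : ℝ) : EReal) ≤ z := by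
  induction z with
  | bot => simp [-EReal.coe_sub]
  | top => simp
  | coe z =>
    rw [← EReal.coe_sub, EReal.coe_le_coe_iff, EReal.coe_le_coe_iff]
    constructor <;> intro h <;> linarith

namespace IsInnerProduct

section Algebra

variable {E : Type*} [AddCommGroup E] [Module ℝ E] {ip : E → E → ℝ}

theorem add_right (hip : IsInnerProduct ip) (x y z : E) : ip x (y + z) = ip x y + ip x z := by
  rw [hip.symm x, hip.add_left, hip.symm y, hip.symm z]

theorem smul_right (hip : IsInnerProduct ip) (c : ℝ) (x y : E) : ip x (c • y) = c * ip x y := by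
  rw [hip.symm x, hip.smul_left, hip.symm y]

theorem zero_right (hip : IsInnerProduct ip) (x : E) : ip x 0 = 0 := by
  simpa using hip.smul_right 0 x 0

theorem zero_left (hip : IsInnerProduct ip) (x : E) : ip 0 x = 0 := by
  simpa using hip.smul_left 0 0 x

theorem neg_left (hip : IsInnerProduct ip) (x y : E) : ip (-x) y = -ip x y := by
  simpa using hip.smul_left (-1) x y

theorem neg_right (hip : IsInnerProduct ip) (x y : E) : ip x (-y) = -ip x y := by
  simpa using hip.smul_right (-1) x y

theorem sub_right (hip : IsInnerProduct ip) (x y z : E) : ip x (y - z) = ip x y - ip x z := by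
  rw [sub_eq_add_neg, hip.add_right, hip.neg_right, sub_eq_add_neg]

theorem self_nonneg (hip : IsInnerProduct ip) (x : E) : 0 ≤ ip x x := by
  by_cases hx : x = 0
  · simp [hx, hip.zero_right]
  · exact (hip.pos x hx).le

theorem eq_zero (hip : IsInnerProduct ip) {x : E} (hx : ip x x ≤ 0) : x = 0 := by
  by_contra h
  exact absurd (hip.pos x h) (not_lt.2 hx)

/-- The bilinear form as a linear map into the dual space. -/
def toDual (hip : IsInnerProduct ip) : E →ₗ[ℝ] Module.Dual ℝ E :=
  LinearMap.mk₂ ℝ ip hip.add_left (fun c x y => by simp [hip.smul_left]) hip.add_right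
    (fun c x y => by simp [hip.smul_right])

theorem toDual_apply (hip : IsInnerProduct ip) (x y : E) : hip.toDual x y = ip x y := rfl

/-- Positive definiteness makes `toDual` injective, and equality of dimensions makes it surjective.
-/
theorem exists_eq (hip : IsInnerProduct ip) [FiniteDimensional ℝ E] (f : E →ₗ[ℝ] ℝ) :
    ∃ y, ∀ x, f x = ip x y := by
  have hinj : Function.Injective hip.toDual := by
    rw [← LinearMap.ker_eq_bot, LinearMap.ker_eq_bot']
    intro x hx
    refine hip.eq_zero ?_
    rw [← hip.toDual_apply, hx]
    simp
  obtain ⟨y, hy⟩ :=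
    (LinearMap.injective_iff_surjective_of_finrank_eq_finrank
      (Subspace.dual_finrank_eq (K := ℝ) (V := E)).symm).1 hinj f
  exact ⟨y, fun x => by rw [← hy, hip.toDual_apply, hip.symm]⟩

theorem prod {F : Type*} [AddCommGroup F] [Module ℝ F] {ip' : F → F → ℝ}
    (hip : IsInnerProduct ip) (hip' : IsInnerProduct ip') :
    IsInnerProduct (fun P Q : E × F => ip P.1 Q.1 + ip' P.2 Q.2) where
  add_left x y z := by simp only [Prod.fst_add, Prod.snd_add, hip.add_left, hip'.add_left]; ring
  smul_left c x z := by
    simp only [Prod.smul_fst, Prod.smul_snd, hip.smul_left, hip'.smul_left]; ring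
  symm x y := by simp only [hip.symm x.1, hip'.symm x.2]
  pos x hx := by
    rcases x with ⟨x, y⟩
    by_cases h : x = 0
    · have hy : y ≠ 0 := fun h' => hx (by simp [h, h'])
      have := hip'.pos y hy
      have := hip.self_nonneg x
      simp only; linarith
    · have := hip.pos x h
      have := hip'.self_nonneg y
      simp only; linarith

end Algebra

section Topological

variable {E : Type*} [AddCommGroup E] [Module ℝ E] [TopologicalSpace E] [IsTopologicalAddGroup E]
  [ContinuousSMul ℝ E] [T2Space E] [FiniteDimensional ℝ E] {ip : E → E → ℝ}

theorem continuous_right (hip : IsInnerProduct ip) (x : E) : Continuous (ip x) :=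
  (hip.toDual x).continuous_of_finiteDimensional

theorem continuous_left (hip : IsInnerProduct ip) (y : E) : Continuous fun x => ip x y := by
  simpa only [hip.symm _ y] using hip.continuous_right y

end Topological

end IsInnerProduct

/-! ### Separation of a point from a convex set. -/

section Separation

/-- If 0 lies in the affine hull, that hull is the whole space, so `S` has interior and Hahn–Banach
applies to it. Otherwise 0 is strictly separated from the affine hull, which is closed. -/
theorem exists_nonzero_nonpos_of_span_eq_top {V : Type*} [NormedAddCommGroup V] [NormedSpace ℝ V]
    [FiniteDimensional ℝ V] {S : Set V} (hS : Convex ℝ S) (hne : S.Nonempty) (h0 : (0 : V) ∉ S)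
    (hspan : Submodule.span ℝ S = ⊤) : ∃ f : V →ₗ[ℝ] ℝ, f ≠ 0 ∧ ∀ x ∈ S, f x ≤ 0 := by
  by_cases h : (0 : V) ∈ affineSpan ℝ S
  · have htop : affineSpan ℝ S = ⊤ := by
      rw [← AffineSubspace.direction_eq_top_iff_of_nonempty ⟨0, h⟩, eq_top_iff, ← hspan,
        Submodule.span_le]
      intro x hx
      simpa using AffineSubspace.vsub_mem_direction (subset_affineSpan ℝ S hx) h
    obtain ⟨f, hf, hfS⟩ := geometric_hahn_banach_of_nonempty_interior_point hS
      (fun hx => h0 (interior_subset hx)) (hS.interior_nonempty_iff_affineSpan_eq_top.2 htop)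
    refine ⟨f.toLinearMap, fun h => hf ?_, fun x hx => by simpa using hfS x hx⟩
    ext x
    simpa using LinearMap.congr_fun h x
  · obtain ⟨f, u, hf0, hfS⟩ := geometric_hahn_banach_point_closed (affineSpan ℝ S).convex
      (AffineSubspace.closed_of_finiteDimensional _) h
    have hneg : ∀ x ∈ S, f x > 0 := fun x hx => by
      have := hfS x (subset_affineSpan ℝ S hx)
      simp at hf0
      linarith
    refine ⟨-f.toLinearMap, fun h => ?_, fun x hx => by simpa using (hneg x hx).le⟩
    obtain ⟨x, hx⟩ := hne
    have h1 := LinearMap.congr_fun h x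
    have h2 := hneg x hx
    simp at h1
    linarith

/-- Working inside the span of `S` makes separation proper: a functional vanishing on `S` would
vanish on its span, contrary to `f ≠ 0`. -/
theorem Convex.exists_proper_separation_normed {V : Type*} [NormedAddCommGroup V]
    [NormedSpace ℝ V] [FiniteDimensional ℝ V] {S : Set V} (hS : Convex ℝ S) (hne : S.Nonempty)
    (h0 : (0 : V) ∉ S) : ∃ f : V →ₗ[ℝ] ℝ, (∀ x ∈ S, f x ≤ 0) ∧ ∃ x ∈ S, f x < 0 := by
  let L := Submodule.span ℝ S
  let T : Set L := Subtype.val ⁻¹' S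
  have hT : Convex ℝ T := hS.linear_preimage L.subtype
  have hspan : Submodule.span ℝ T = ⊤ := Submodule.span_span_coe_preimage
  obtain ⟨x₀, hx₀⟩ := hne
  obtain ⟨f, hf, hfT⟩ := exists_nonzero_nonpos_of_span_eq_top hT
    ⟨⟨x₀, Submodule.subset_span hx₀⟩, hx₀⟩ (fun h => h0 h) hspan
  obtain ⟨g, hg⟩ := f.exists_extend
  have hgf : ∀ x : L, g x = f x := fun x => LinearMap.congr_fun hg x
  refine ⟨g, fun x hx => ?_, ?_⟩
  · exact (hgf ⟨x, Submodule.subset_span hx⟩).trans_le (hfT _ hx)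
  · by_contra! hcon
    refine hf (LinearMap.ext_on hspan fun x hx => ?_)
    exact le_antisymm (hfT x hx) ((hcon x hx).trans_eq (hgf x))

variable {E : Type*} [AddCommGroup E] [Module ℝ E] [TopologicalSpace E] [IsTopologicalAddGroup E]
  [ContinuousSMul ℝ E] [T2Space E] [FiniteDimensional ℝ E]

/-- A point outside a convex set of a finite-dimensional space can be properly separated from it. -/
theorem Convex.exists_proper_separation {S : Set E} (hS : Convex ℝ S) (hne : S.Nonempty)
    (h0 : (0 : E) ∉ S) : ∃ f : E →ₗ[ℝ] ℝ, (∀ x ∈ S, f x ≤ 0) ∧ ∃ x ∈ S, f x < 0 := by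
  let e := toEuclidean (E := E)
  have hS' : Convex ℝ (e '' S) := hS.linear_image e.toLinearMap
  obtain ⟨f, hf, x, ⟨z, hz, rfl⟩, hx⟩ := hS'.exists_proper_separation_normed (hne.image e)
    (by rintro ⟨x, hx, hx0⟩; rw [map_eq_zero_iff _ e.injective] at hx0; exact h0 (hx0 ▸ hx))
  exact ⟨f ∘ₗ e.toLinearMap, fun x hx => hf _ ⟨x, hx, rfl⟩, z, hz, hx⟩

theorem Convex.exists_strict_separation {S : Set E} (hS : Convex ℝ S) (hc : IsClosed S) {y : E}
    (hy : y ∉ S) : ∃ (f : E →ₗ[ℝ] ℝ) (u : ℝ), (∀ x ∈ S, f x < u) ∧ u < f y := by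
  let e := toEuclidean (E := E)
  have hS' : Convex ℝ (e '' S) := hS.linear_image e.toLinearMap
  have hc' : IsClosed (e '' S) := e.toHomeomorph.isClosed_image.2 hc
  obtain ⟨f, u, hf, hu⟩ := geometric_hahn_banach_closed_point hS' hc'
    (x := e y) (by rintro ⟨x, hx, hx0⟩; exact hy (e.injective hx0 ▸ hx))
  exact ⟨f.toLinearMap ∘ₗ e.toLinearMap, u, fun x hx => hf _ ⟨x, hx, rfl⟩, hu⟩

end Separation

/-! ### Closedness of a sum of closed sets. -/

section ClosedSum

/-- Decompose a convergent sequence as `c k + κ k`. If `‖c k‖ → ∞`, rescaling yields a unit horizon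
direction of `C` whose negative lies in `K`, which is excluded. Otherwise a subsequence of `c k`
converges, and `κ k` converges along it. -/
theorem isClosed_add_of_horizonCone_normed {V : Type*} [NormedAddCommGroup V] [NormedSpace ℝ V]
    [FiniteDimensional ℝ V] {C K : Set V} (hC : IsClosed C) (hK : IsClosed K)
    (hcone : ∀ t : ℝ, 0 < t → ∀ x ∈ K, t • x ∈ K) (h : horizonCone C ∩ -K ⊆ {0}) :
    IsClosed (C + K) := by
  refine IsSeqClosed.isClosed ?_
  intro x z hx hxz
  choose c hc κ hκ hsum using hx
  simp only at hsum
  by_cases hlim : Filter.Tendsto (fun k => ‖c k‖) Filter.atTop Filter.atTop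
  · exfalso
    -- The added 1 avoids division by zero; the rescaled norm is `1 - t k`, which still tends to 1.
    let t : ℕ → ℝ := fun k => (1 + ‖c k‖)⁻¹
    have htpos : ∀ k, 0 < t k := fun k => by positivity
    have ht : Filter.Tendsto t Filter.atTop (𝓝 0) :=
      tendsto_inv_atTop_zero.comp (Filter.tendsto_atTop_add_const_left _ 1 hlim)
    have hnorm : ∀ k, ‖t k • c k‖ = 1 - t k := fun k => by
      have : (1 + ‖c k‖) ≠ 0 := by positivity
      rw [norm_smul, Real.norm_of_nonneg (htpos k).le]
      simp only [t]
      field_simp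
      ring
    obtain ⟨w, -, φ, hφ, hw⟩ := tendsto_subseq_of_bounded
      (Metric.isBounded_closedBall (x := (0 : V)) (r := 1)) (x := fun k => t k • c k)
      (fun k => by rw [mem_closedBall_zero_iff, hnorm]; linarith [htpos k])
    have htφ := ht.comp hφ.tendsto_atTop
    have hw1 : ‖w‖ = 1 := by
      refine tendsto_nhds_unique hw.norm ?_
      have := htφ.const_sub 1
      simp only [sub_zero] at this
      exact this.congr fun k => (hnorm _).symm
    have hwC : w ∈ horizonCone C := ⟨t ∘ φ, c ∘ φ, fun k => htpos _, fun k => hc _, htφ, hw⟩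
    have hwK : -w ∈ K := by
      refine hK.mem_of_tendsto (b := Filter.atTop) (f := fun k => t (φ k) • κ (φ k)) ?_
        (Filter.Eventually.of_forall fun k => hcone _ (htpos _) _ (hκ _))
      have h1 := (htφ.smul (hxz.comp hφ.tendsto_atTop)).sub hw
      simp only [zero_smul, zero_sub] at h1
      refine h1.congr fun k => ?_
      simp only [Function.comp, ← hsum, smul_add, add_sub_cancel_left]
    have : w = 0 := h ⟨hwC, by simpa using hwK⟩
    simp [this] at hw1
  · rw [Filter.tendsto_atTop] at hlim
    push Not at hlim
    obtain ⟨M, hM⟩ := hlim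
    obtain ⟨a, -, φ, hφ, ha⟩ := tendsto_subseq_of_frequently_bounded
      (Metric.isBounded_closedBall (x := (0 : V)) (r := M)) (x := c)
      (hM.mono fun k hk => by rw [mem_closedBall_zero_iff]; exact hk.le)
    have haC : a ∈ C := hC.mem_of_tendsto ha (Filter.Eventually.of_forall fun k => hc _)
    have hbK : z - a ∈ K := by
      refine hK.mem_of_tendsto (b := Filter.atTop) (f := fun k => κ (φ k)) ?_
        (Filter.Eventually.of_forall fun k => hκ _)
      refine ((hxz.comp hφ.tendsto_atTop).sub ha).congr fun k => ?_
      simp only [Function.comp, ← hsum, add_sub_cancel_left]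
    exact ⟨a, haC, z - a, hbK, by simp⟩

theorem isClosed_add_of_horizonCone {E : Type*} [AddCommGroup E] [Module ℝ E] [TopologicalSpace E]
    [IsTopologicalAddGroup E] [ContinuousSMul ℝ E] [T2Space E] [FiniteDimensional ℝ E]
    {C K : Set E} (hC : IsClosed C) (hK : IsClosed K)
    (hcone : ∀ t : ℝ, 0 < t → ∀ x ∈ K, t • x ∈ K) (h : horizonCone C ∩ -K ⊆ {0}) :
    IsClosed (C + K) := by
  let e := toEuclidean (E := E)
  have key : IsClosed (e '' C + e '' K) := by
    refine isClosed_add_of_horizonCone_normed (e.toHomeomorph.isClosed_image.2 hC)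
      (e.toHomeomorph.isClosed_image.2 hK) ?_ ?_
    · rintro t ht _ ⟨x, hx, rfl⟩
      exact ⟨t • x, hcone t ht x hx, map_smul e t x⟩
    · rintro w ⟨⟨t, x, ht, hx, ht0, hw⟩, ⟨y, hy, hyw⟩⟩
      have h1 : e.symm w ∈ horizonCone C := by
        refine ⟨t, fun k => e.symm (x k), ht, fun k => ?_, ht0, ?_⟩
        · obtain ⟨y, hy, hyx⟩ := hx k
          simp only
          rw [← hyx]; simpa using hy
        · simpa [Function.comp_def] using (e.symm.continuous.tendsto w).comp hw
      have h2 : -e.symm w ∈ K := by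
        rw [← map_neg, ← hyw]; simpa using hy
      have := h ⟨h1, h2⟩
      simpa using this
  rw [← Set.image_add] at key
  exact e.toHomeomorph.isClosed_image.1 key

end ClosedSum

/-! ### Support functions, barrier cones and horizon cones. -/

section SupportFunction

variable {E : Type*} {ip : E → E → ℝ}

theorem supportFn_le_coe_iff {S : Set E} {x : E} {r : ℝ} :
    supportFn ip S x ≤ r ↔ ∀ v ∈ S, ip v x ≤ r := by
  simp [supportFn]

theorem le_supportFn {S : Set E} {v : E} (hv : v ∈ S) (x : E) :
    (ip v x : EReal) ≤ supportFn ip S x :=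
  le_iSup₂ (f := fun v (_ : v ∈ S) => (ip v x : EReal)) v hv

theorem supportFn_ne_bot {S : Set E} (hS : S.Nonempty) (x : E) : supportFn ip S x ≠ ⊥ := by
  obtain ⟨v, hv⟩ := hS
  exact ne_bot_of_le_ne_bot (EReal.coe_ne_bot _) (le_supportFn hv x)

theorem EReal.lt_top_iff_exists_le_coe {a : EReal} : a < ⊤ ↔ ∃ r : ℝ, a ≤ r := by
  constructor
  · intro h
    obtain ⟨r, hr, -⟩ := EReal.lt_iff_exists_real_btwn.1 h
    exact ⟨r, hr.le⟩
  · rintro ⟨r, hr⟩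
    exact hr.trans_lt (EReal.coe_lt_top r)

theorem mem_barrierCone_iff {S : Set E} {x : E} :
    x ∈ barrierCone ip S ↔ ∃ r : ℝ, ∀ v ∈ S, ip v x ≤ r := by
  simp only [barrierCone, effDomain, Set.mem_ofPred_eq, EReal.lt_top_iff_exists_le_coe,
    supportFn_le_coe_iff]

theorem fenchelConj_le_coe_iff {f : E → EReal} {y : E} {r : ℝ} :
    fenchelConj ip f y ≤ r ↔ ∀ x, ((ip x y - r : ℝ) : EReal) ≤ f x := by
  simp only [fenchelConj, iSup_le_iff, EReal.coe_sub_le_coe_iff]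

theorem fenchelConj_indicatorFn (S : Set E) :
    fenchelConj ip (indicatorFn S) = supportFn ip S := by
  funext y
  refine iSup_congr fun x => ?_
  by_cases hx : x ∈ S <;> simp [indicatorFn, hx]

theorem effDomain_indicatorFn (S : Set E) : effDomain (indicatorFn S) = S := by
  ext x
  by_cases hx : x ∈ S <;> simp [effDomain, indicatorFn, hx]

variable [AddCommGroup E] [Module ℝ E]

theorem supportFn_zero (hip : IsInnerProduct ip) {S : Set E} (hS : S.Nonempty) :
    supportFn ip S 0 = 0 := by
  refine le_antisymm ?_ ?_
  · rw [← EReal.coe_zero, supportFn_le_coe_iff]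
    intro v _
    rw [hip.zero_right]
  · obtain ⟨v, hv⟩ := hS
    simpa [hip.zero_right] using le_supportFn (ip := ip) hv 0

theorem zero_mem_barrierCone (hip : IsInnerProduct ip) (S : Set E) :
    (0 : E) ∈ barrierCone ip S :=
  mem_barrierCone_iff.2 ⟨0, fun v _ => by rw [hip.zero_right]⟩

theorem smul_mem_barrierCone (hip : IsInnerProduct ip) {S : Set E} {x : E}
    (hx : x ∈ barrierCone ip S) {t : ℝ} (ht : 0 ≤ t) : t • x ∈ barrierCone ip S := by
  obtain ⟨r, hr⟩ := mem_barrierCone_iff.1 hx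
  refine mem_barrierCone_iff.2 ⟨t * r, fun v hv => ?_⟩
  rw [hip.smul_right]
  exact mul_le_mul_of_nonneg_left (hr v hv) ht

theorem convex_barrierCone (hip : IsInnerProduct ip) (S : Set E) :
    Convex ℝ (barrierCone ip S) := by
  intro x hx y hy a b ha hb _
  obtain ⟨r, hr⟩ := mem_barrierCone_iff.1 (smul_mem_barrierCone hip hx ha)
  obtain ⟨s, hs⟩ := mem_barrierCone_iff.1 (smul_mem_barrierCone hip hy hb)
  refine mem_barrierCone_iff.2 ⟨r + s, fun v hv => ?_⟩
  rw [hip.add_right]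
  exact add_le_add (hr v hv) (hs v hv)

theorem mem_polarSet_iff_of_cone (hip : IsInnerProduct ip) {K : Set E}
    (hK : ∀ t : ℝ, 0 ≤ t → ∀ x ∈ K, t • x ∈ K) {v : E} :
    v ∈ polarSet ip K ↔ ∀ x ∈ K, ip v x ≤ 0 := by
  refine ⟨fun h x hx => ?_, fun h x hx => (h x hx).trans zero_le_one⟩
  by_contra! hpos
  have := h _ (hK (2 / ip v x) (by positivity) x hx)
  rw [hip.smul_right, div_mul_cancel₀ _ hpos.ne'] at this
  norm_num at this

variable [TopologicalSpace E] [IsTopologicalAddGroup E] [ContinuousSMul ℝ E] [T2Space E]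
  [FiniteDimensional ℝ E]

theorem isClosed_polarSet (hip : IsInnerProduct ip) (S : Set E) : IsClosed (polarSet ip S) := by
  simp only [polarSet, Set.ofPred_forall]
  exact isClosed_biInter fun x _ => isClosed_le (hip.continuous_left x) continuous_const

/-- On the closure every pairing is dominated by the support function, with equality at 0. Off the
closure, a strictly separating direction can be scaled up to drive the conjugate to `⊤`. -/
theorem fenchelConj_supportFn (hip : IsInnerProduct ip) {S : Set E} (hne : S.Nonempty)
    (hS : Convex ℝ S) : fenchelConj ip (supportFn ip S) = indicatorFn (closure S) := by
  funext y
  by_cases hy : y ∈ closure S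
  · rw [indicatorFn, if_pos hy]
    refine le_antisymm ?_ ?_
    · rw [← EReal.coe_zero, fenchelConj_le_coe_iff]
      intro x
      rw [sub_zero, hip.symm]
      have hcl : IsClosed {z : E | ((ip z x : ℝ) : EReal) ≤ supportFn ip S x} :=
        isClosed_Iic.preimage (continuous_coe_real_ereal.comp (hip.continuous_left x))
      exact closure_minimal (fun v hv => le_supportFn hv x) hcl hy
    · refine le_trans ?_ (le_iSup _ (0 : E))
      simp [hip.zero_left, supportFn_zero hip hne]
  · rw [indicatorFn, if_neg hy, EReal.eq_top_iff_forall_lt]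
    intro r
    obtain ⟨f, u, hf, hu⟩ := hS.closure.exists_strict_separation isClosed_closure hy
    obtain ⟨x, hx⟩ := hip.exists_eq f
    simp only [hx] at hf hu
    by_contra! hle
    rw [fenchelConj_le_coe_iff] at hle
    have hpos : 0 < ip y x - u := by linarith
    -- Chosen so that the separation gap, scaled by `t`, equals `|r| + 1` and exceeds `r`.
    let t := (|r| + 1) / (ip y x - u)
    have ht : 0 < t := by positivity
    have hub : supportFn ip S (t • x) ≤ ((t * u : ℝ) : EReal) :=
      supportFn_le_coe_iff.2 fun v hv => by
        rw [hip.smul_right]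
        exact mul_le_mul_of_nonneg_left (hf v (subset_closure hv)).le ht.le
    have h1 := EReal.coe_le_coe_iff.1 ((hle (t • x)).trans hub)
    rw [hip.smul_left, hip.symm] at h1
    have h2 : t * (ip y x - u) = |r| + 1 := div_mul_cancel₀ _ hpos.ne'
    nlinarith [le_abs_self r]

theorem fenchelConj_fenchelConj_supportFn (hip : IsInnerProduct ip) {S : Set E} (hne : S.Nonempty)
    (hS : Convex ℝ S) :
    fenchelConj ip (fenchelConj ip (supportFn ip S)) = supportFn ip S := by
  rw [fenchelConj_supportFn hip hne hS, fenchelConj_indicatorFn]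
  funext x
  refine EReal.eq_of_forall_le_coe_iff fun r => ?_
  rw [supportFn_le_coe_iff, supportFn_le_coe_iff]
  refine ⟨fun h v hv => h v (subset_closure hv), fun h v hv => ?_⟩
  exact closure_minimal h (isClosed_le (hip.continuous_left x) continuous_const) hv

/-- The epigraph is an intersection of closed half-spaces. -/
theorem isClosedProperConvex_supportFn (hip : IsInnerProduct ip) {S : Set E} (hne : S.Nonempty) :
    IsClosedProperConvex (supportFn ip S) := by
  have hepi : epi (supportFn ip S) = ⋂ v ∈ S, {q : E × ℝ | ip v q.1 ≤ q.2} := by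
    ext q
    simp [epi, supportFn_le_coe_iff]
  refine ⟨⟨supportFn_ne_bot hne, 0, ?_⟩, ?_, ?_⟩
  · simp [effDomain, supportFn_zero hip hne]
  · rw [hepi]
    refine convex_iInter₂ fun v _ => ?_
    intro x hx y hy a b ha hb _
    simp only [Set.mem_ofPred_eq, Prod.fst_add, Prod.snd_add, Prod.smul_fst, Prod.smul_snd,
      hip.add_right, hip.smul_right, smul_eq_mul] at hx hy ⊢
    exact add_le_add (mul_le_mul_of_nonneg_left hx ha) (mul_le_mul_of_nonneg_left hy hb)
  · rw [hepi]
    exact isClosed_biInter fun v _ =>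
      isClosed_le ((hip.continuous_right v).comp continuous_fst) continuous_snd

theorem ip_nonpos_of_mem_horizonCone (hip : IsInnerProduct ip) {S : Set E} {w x : E}
    (hw : w ∈ horizonCone S) (hx : x ∈ closure (barrierCone ip S)) : ip w x ≤ 0 := by
  refine closure_minimal (t := {x | ip w x ≤ 0}) ?_
    (isClosed_le (hip.continuous_right w) continuous_const) hx
  intro b hb
  obtain ⟨r, hr⟩ := mem_barrierCone_iff.1 hb
  obtain ⟨t, v, ht, hv, ht0, hlim⟩ := hw
  have h1 := ((hip.continuous_left b).tendsto w).comp hlim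
  have h2 := ht0.mul_const r
  rw [zero_mul] at h2
  refine le_of_tendsto_of_tendsto' h1 h2 fun k => ?_
  simp only [Function.comp, hip.smul_left]
  exact mul_le_mul_of_nonneg_left (hr _ (hv k)) (ht k).le

/-- If a ray from a point of `S` in direction `w` left `S`, a functional strictly separating the
exit point would be bounded above on `S`, hence given by a barrier vector, yet positive on `w`. -/
theorem mem_horizonCone_of_forall_barrierCone (hip : IsInnerProduct ip) {S : Set E}
    (hne : S.Nonempty) (hc : IsClosed S) (hS : Convex ℝ S) {w : E}
    (hw : ∀ b ∈ barrierCone ip S, ip w b ≤ 0) : w ∈ horizonCone S := by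
  obtain ⟨v, hv⟩ := hne
  have hray : ∀ t : ℝ, 0 ≤ t → v + t • w ∈ S := by
    intro t ht
    by_contra hcon
    obtain ⟨f, u, hf, hu⟩ := hS.exists_strict_separation hc hcon
    obtain ⟨b, hb⟩ := hip.exists_eq f
    simp only [hb] at hf hu
    have h1 := hw b (mem_barrierCone_iff.2 ⟨u, fun v hv => (hf v hv).le⟩)
    rw [hip.add_left, hip.smul_left] at hu
    have h2 := hf v hv
    nlinarith
  refine ⟨fun k => 1 / ((k : ℝ) + 1), fun k => v + ((k : ℝ) + 1) • w, fun k => by positivity,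
    fun k => hray _ (by positivity), tendsto_one_div_add_atTop_nhds_zero_nat, ?_⟩
  have h1 := ((tendsto_one_div_add_atTop_nhds_zero_nat (𝕜 := ℝ)).smul_const v).add_const w
  rw [zero_smul, zero_add] at h1
  refine h1.congr fun k => ?_
  have : ((k : ℝ) + 1) ≠ 0 := by positivity
  rw [smul_add, smul_smul, one_div_mul_cancel this, one_smul]

/-- If the two convex sets were disjoint, a proper separator `w` would be nonpositive on the barrier
cone, hence a horizon direction, and nonnegative on `K`. The hypothesis then forces `w = 0`,
contradicting properness. -/
theorem barrierCone_inter_interior_nonempty (hip : IsInnerProduct ip) {S K : Set E}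
    (hne : S.Nonempty) (hc : IsClosed S) (hS : Convex ℝ S) (hK : Convex ℝ K)
    (hcone : ∀ t : ℝ, 0 ≤ t → ∀ x ∈ K, t • x ∈ K) (hint : (interior K).Nonempty)
    (h : horizonCone S ∩ (-polarSet ip K) ⊆ {0}) :
    (barrierCone ip S ∩ interior K).Nonempty := by
  by_contra hemp
  rw [Set.not_nonempty_iff_eq_empty, ← Set.disjoint_iff_inter_eq_empty] at hemp
  obtain ⟨f, hf, x, hx, hfx⟩ := ((convex_barrierCone hip S).sub hK.interior).exists_proper_separation
    (Set.Nonempty.sub ⟨0, zero_mem_barrierCone hip S⟩ hint) (by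
      rw [Set.mem_sub]
      rintro ⟨b, hb, k, hk, hbk⟩
      exact Set.disjoint_left.1 hemp hb (sub_eq_zero.1 hbk ▸ hk))
  obtain ⟨w, hw⟩ := hip.exists_eq f
  have hsep : ∀ b ∈ barrierCone ip S, ∀ k ∈ interior K, ip w b ≤ ip w k := fun b hb k hk => by
    have := hf _ (Set.sub_mem_sub hb hk)
    rw [hw, hip.symm, hip.sub_right] at this
    linarith
  have hwK : -w ∈ polarSet ip K := by
    rw [mem_polarSet_iff_of_cone hip hcone]
    intro k hk
    have hcl : k ∈ closure (interior K) := by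
      rw [hK.closure_interior_eq_closure_of_nonempty_interior hint]
      exact subset_closure hk
    refine closure_minimal (t := {k | ip (-w) k ≤ 0}) ?_
      (isClosed_le (hip.continuous_right _) continuous_const) hcl
    intro z hz
    have := hsep 0 (zero_mem_barrierCone hip S) z hz
    rw [hip.zero_right] at this
    simpa [hip.neg_left] using this
  have hwS : w ∈ horizonCone S := by
    refine mem_horizonCone_of_forall_barrierCone hip hne hc hS fun b hb => ?_
    by_contra! hpos
    obtain ⟨k, hk⟩ := hint
    -- The multiple of `b` is scaled so that its pairing with `w` is `|ip w k| + 1`, beyond the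
    -- bound given by `k`.
    have h1 := hsep _ (smul_mem_barrierCone hip hb
      (t := (|ip w k| + 1) / ip w b) (by positivity)) k hk
    rw [hip.smul_right, div_mul_cancel₀ _ hpos.ne'] at h1
    linarith [le_abs_self (ip w k)]
  have hw0 : w = 0 := h ⟨hwS, hwK⟩
  rw [hw, hw0, hip.zero_right] at hfx
  exact lt_irrefl _ hfx

end SupportFunction

/-- Every point of the relative interior of a set is internal relative to the segments that end
in the set. -/
theorem exists_pos_neg_smul_mem_of_mem_intrinsicInterior {E : Type*} [AddCommGroup E] [Module ℝ E]
    [TopologicalSpace E] [IsTopologicalAddGroup E] [ContinuousSMul ℝ E] {C : Set E}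
    (h : (0 : E) ∈ intrinsicInterior ℝ C) {w : E} (hw : w ∈ C) :
    ∃ ε : ℝ, 0 < ε ∧ -(ε • w) ∈ C := by
  obtain ⟨⟨z, hz⟩, hzi, hz0⟩ := mem_intrinsicInterior.1 h
  simp only at hz0
  subst hz0
  have hline : ∀ ε : ℝ, -(ε • w) ∈ affineSpan ℝ C := fun ε => by
    have := AffineMap.lineMap_mem (-ε) hz (subset_affineSpan ℝ C hw)
    simpa [AffineMap.lineMap_apply] using this
  let g : ℝ → affineSpan ℝ C := fun ε => ⟨-(ε • w), hline ε⟩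
  have hg : Continuous g := by
    refine Continuous.subtype_mk ?_ _
    fun_prop
  have hg0 : g 0 = ⟨0, hz⟩ := Subtype.ext (by simp [g])
  have hnhds : ∀ᶠ ε in 𝓝 (0 : ℝ), g ε ∈ interior ((↑) ⁻¹' C : Set (affineSpan ℝ C)) :=
    hg.continuousAt.eventually_mem (by rw [hg0]; exact isOpen_interior.mem_nhds hzi)
  obtain ⟨δ, hδ, hball⟩ := Metric.eventually_nhds_iff.1 hnhds
  refine ⟨δ / 2, by positivity, ?_⟩
  refine interior_subset (s := ((↑) ⁻¹' C : Set (affineSpan ℝ C))) (hball (y := δ / 2) ?_)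
  rw [Real.dist_eq, sub_zero, abs_of_pos (by positivity)]
  linarith

/-! ### Linear minorants of sublinear functions. -/

section Sublinear

/-- Hahn–Banach extends `c • x₀ ↦ c * N x₀` from the line through `x₀`; for `c < 0` domination there
comes from `0 = N 0 ≤ N (c • x₀) + N (-c • x₀)`. -/
theorem exists_linear_le_of_sublinear {E : Type*} [AddCommGroup E] [Module ℝ E] (N : E → ℝ)
    (hom : ∀ c : ℝ, 0 < c → ∀ x, N (c • x) = c * N x) (hadd : ∀ x y, N (x + y) ≤ N x + N y)
    (x₀ : E) : ∃ g : E →ₗ[ℝ] ℝ, (∀ x, g x ≤ N x) ∧ g x₀ = N x₀ := by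
  have h0 : N 0 = 0 := by
    have := hom 2 two_pos 0
    rw [smul_zero] at this
    linarith
  by_cases hx : x₀ = 0
  · obtain ⟨g, -, hg⟩ := exists_extension_of_le_sublinear ((0 : E →ₗ[ℝ] ℝ).toPMap ⊥) N hom hadd (by
      rintro ⟨x, hx⟩
      obtain rfl : x = 0 := (Submodule.mem_bot ℝ).1 hx
      simp [h0])
    exact ⟨g, hg, by rw [hx, map_zero, h0]⟩
  · obtain ⟨g, hg, hgN⟩ := exists_extension_of_le_sublinear
      (LinearPMap.mkSpanSingleton x₀ (N x₀) hx) N hom hadd (by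
        rintro ⟨x, hx'⟩
        obtain ⟨c, rfl⟩ := Submodule.mem_span_singleton.1 hx'
        rw [LinearPMap.mkSpanSingleton'_apply, smul_eq_mul, RingHom.id_apply]
        change c * N x₀ ≤ N (c • x₀)
        rcases lt_trichotomy c 0 with hc | rfl | hc
        · have h1 := hom (-c) (by linarith) x₀
          have h2 := hadd (c • x₀) ((-c) • x₀)
          rw [neg_smul, add_neg_cancel, h0, ← neg_smul, h1] at h2
          linarith
        · simp [h0]
        · exact (hom c hc x₀).ge)
    refine ⟨g, hgN, ?_⟩
    have h1 := hg ⟨x₀, Submodule.mem_span_singleton_self x₀⟩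
    exact h1.trans (LinearPMap.mkSpanSingleton_apply ℝ ℝ hx (N x₀))

end Sublinear

/-! ### Duality for infimal projections of support functions. -/

section InfimalProjection

variable {E F : Type*} {ipE : E → E → ℝ} {ipF : F → F → ℝ}

/-- The inner product of a product space. -/
def prodIp (ipE : E → E → ℝ) (ipF : F → F → ℝ) (P Q : E × F) : ℝ := ipE P.1 Q.1 + ipF P.2 Q.2

/-- The infimal projection of the support function of a subset of a product space. -/
noncomputable def infSupp (ipE : E → E → ℝ) (ipF : F → F → ℝ) (S : Set (E × F)) (X : E) : EReal :=
  ⨅ V : F, supportFn (prodIp ipE ipF) S (X, V)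

theorem infSupp_le_coe {S : Set (E × F)} {X : E} {V : F} {r : ℝ}
    (h : ∀ P ∈ S, ipE P.1 X + ipF P.2 V ≤ r) : infSupp ipE ipF S X ≤ r :=
  (iInf_le _ V).trans (supportFn_le_coe_iff.2 h)

theorem exists_of_infSupp_lt {S : Set (E × F)} {X : E} {r : ℝ} (h : infSupp ipE ipF S X < r) :
    ∃ V, ∀ P ∈ S, ipE P.1 X + ipF P.2 V ≤ r := by
  obtain ⟨V, hV⟩ := iInf_lt_iff.1 h
  exact ⟨V, supportFn_le_coe_iff.1 hV.le⟩

/-- Weak duality. -/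
theorem supportFn_section_le_infSupp [AddCommGroup F] [Module ℝ F]
    (hF : IsInnerProduct ipF) (S : Set (E × F)) (X : E) :
    supportFn ipE {Y | (Y, (0 : F)) ∈ S} X ≤ infSupp ipE ipF S X := by
  refine le_iInf fun V => iSup₂_le fun Y hY => ?_
  simpa [prodIp, hF.zero_left] using le_supportFn (ip := prodIp ipE ipF) (S := S) hY (X, V)

variable [AddCommGroup E] [Module ℝ E] [AddCommGroup F] [Module ℝ F]

theorem infSupp_add_le (hE : IsInnerProduct ipE) (hF : IsInnerProduct ipF) {S : Set (E × F)}
    {X₁ X₂ : E} {r s : ℝ} (h₁ : infSupp ipE ipF S X₁ < r) (h₂ : infSupp ipE ipF S X₂ < s) :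
    infSupp ipE ipF S (X₁ + X₂) ≤ ((r + s : ℝ) : EReal) := by
  obtain ⟨V₁, hV₁⟩ := exists_of_infSupp_lt h₁
  obtain ⟨V₂, hV₂⟩ := exists_of_infSupp_lt h₂
  refine infSupp_le_coe (V := V₁ + V₂) fun P hP => ?_
  rw [hE.add_right, hF.add_right]
  linarith [hV₁ P hP, hV₂ P hP]

theorem infSupp_smul_le (hE : IsInnerProduct ipE) (hF : IsInnerProduct ipF) {S : Set (E × F)}
    {X : E} {r c : ℝ} (hc : 0 < c) (h : infSupp ipE ipF S X < r) :
    infSupp ipE ipF S (c • X) ≤ ((c * r : ℝ) : EReal) := by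
  obtain ⟨V, hV⟩ := exists_of_infSupp_lt h
  refine infSupp_le_coe (V := c • V) fun P hP => ?_
  rw [hE.smul_right, hF.smul_right, ← mul_add]
  exact mul_le_mul_of_nonneg_left (hV P hP) hc.le

/-- Subadditivity bounds the value at `X` by those at `X₀` and `X - X₀`; the first is `⊥` and the
second is not `⊤`. -/
theorem infSupp_eq_bot_of_eq_bot (hE : IsInnerProduct ipE) (hF : IsInnerProduct ipF)
    {S : Set (E × F)} (hfin : ∀ X, infSupp ipE ipF S X < ⊤) {X₀ : E}
    (h : infSupp ipE ipF S X₀ = ⊥) (X : E) : infSupp ipE ipF S X = ⊥ := by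
  obtain ⟨s, hs, -⟩ := EReal.lt_iff_exists_real_btwn.1 (hfin (X - X₀))
  rw [EReal.eq_bot_iff_forall_lt]
  intro r
  have h1 : infSupp ipE ipF S X₀ < ((r - 1 - s : ℝ) : EReal) := h ▸ EReal.bot_lt_coe _
  have h2 := infSupp_add_le hE hF h1 hs
  rw [add_sub_cancel] at h2
  exact h2.trans_lt (EReal.coe_lt_coe_iff.2 (by linarith))

theorem exists_linear_le_infSupp (hE : IsInnerProduct ipE) (hF : IsInnerProduct ipF)
    [FiniteDimensional ℝ E] {S : Set (E × F)} (hfin : ∀ X, infSupp ipE ipF S X < ⊤)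
    (hbot : ∀ X, infSupp ipE ipF S X ≠ ⊥) (X₀ : E) :
    ∃ Y, (∀ X, (ipE X Y : EReal) ≤ infSupp ipE ipF S X) ∧
      infSupp ipE ipF S X₀ = (ipE X₀ Y : EReal) := by
  let N : E → ℝ := fun X => (infSupp ipE ipF S X).toReal
  have hN : ∀ X, infSupp ipE ipF S X = (N X : EReal) := fun X =>
    (EReal.coe_toReal (hfin X).ne (hbot X)).symm
  have hlt : ∀ X δ, 0 < δ → infSupp ipE ipF S X < ((N X + δ : ℝ) : EReal) := fun X δ hδ => by
    rw [hN, EReal.coe_lt_coe_iff]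
    linarith
  have hsmul : ∀ c : ℝ, 0 < c → ∀ X, N (c • X) ≤ c * N X := fun c hc X => by
    refine le_of_forall_pos_le_add fun δ hδ => ?_
    have := infSupp_smul_le hE hF hc (hlt X (δ / c) (by positivity))
    rw [hN, EReal.coe_le_coe_iff, mul_add, mul_div_cancel₀ _ hc.ne'] at this
    exact this
  obtain ⟨g, hg, hg0⟩ := exists_linear_le_of_sublinear N
    (fun c hc X => le_antisymm (hsmul c hc X) (by
      have := hsmul c⁻¹ (inv_pos.2 hc) (c • X)
      rw [smul_smul, inv_mul_cancel₀ hc.ne', one_smul] at this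
      rwa [inv_mul_eq_div, le_div_iff₀' hc] at this))
    (fun X₁ X₂ => by
      refine le_of_forall_pos_le_add fun δ hδ => ?_
      have := infSupp_add_le hE hF (hlt X₁ (δ / 2) (by positivity)) (hlt X₂ (δ / 2) (by positivity))
      rw [hN, EReal.coe_le_coe_iff] at this
      linarith) X₀
  obtain ⟨Y, hY⟩ := hE.exists_eq g
  refine ⟨Y, fun X => ?_, ?_⟩
  · rw [hN, EReal.coe_le_coe_iff, ← hY]
    exact hg X
  · rw [hN, ← hg0, hY]

/-- A point of `S` over `w` and one over `-(ε • w)` have a convex combination over 0, with weights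
`ε/(1+ε)` and `1/(1+ε)`. -/
theorem section_nonempty_of_internal {S : Set (E × F)} (hne : S.Nonempty) (hS : Convex ℝ S)
    (hint : ∀ w ∈ Prod.snd '' S, ∃ ε : ℝ, 0 < ε ∧ -(ε • w) ∈ Prod.snd '' S) :
    {Y | (Y, (0 : F)) ∈ S}.Nonempty := by
  obtain ⟨P, hP⟩ := hne
  obtain ⟨ε, hε, Q, hQ, hQ2⟩ := hint _ ⟨P, hP, rfl⟩
  have h1 : 0 < 1 + ε := by positivity
  have := hS hP hQ (a := ε / (1 + ε)) (b := 1 / (1 + ε)) (by positivity) (by positivity)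
    (by field_simp; ring)
  have h2 : ((ε / (1 + ε)) • P + (1 / (1 + ε)) • Q).2 = 0 := ?_
  · refine ⟨((ε / (1 + ε)) • P + (1 / (1 + ε)) • Q).1, ?_⟩
    rw [Set.mem_ofPred_eq, ← h2]
    exact this
  simp only [Prod.snd_add, Prod.smul_snd, hQ2, smul_neg, smul_smul]
  rw [one_div_mul_eq_div, add_neg_cancel]

variable [TopologicalSpace F] [IsTopologicalAddGroup F] [ContinuousSMul ℝ F] [T2Space F]
  [FiniteDimensional ℝ F]

/-- Strong duality when the origin is internal to the projection of the set. -/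
theorem infSupp_eq_supportFn_of_internal (hE : IsInnerProduct ipE) (hF : IsInnerProduct ipF)
    {S : Set (E × F)} (hne : S.Nonempty) (hS : Convex ℝ S)
    (hint : ∀ w ∈ Prod.snd '' S, ∃ ε : ℝ, 0 < ε ∧ -(ε • w) ∈ Prod.snd '' S) :
    infSupp ipE ipF S = supportFn ipE {Y | (Y, (0 : F)) ∈ S} := by
  funext X
  refine le_antisymm ?_ (supportFn_section_le_infSupp hF S X)
  refine EReal.le_of_forall_lt_iff_le.1 fun r hr => ?_
  have hr' := supportFn_le_coe_iff.1 hr.le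
  -- `H` records the constraint value together with any amount strictly below the excess of the
  -- objective over `r`. It misses the origin because `r` bounds the objective on the section.
  let H : Set (F × ℝ) := {q | ∃ P ∈ S, q.1 = P.2 ∧ q.2 < ipE P.1 X - r}
  have hH : Convex ℝ H := by
    rintro q ⟨P, hP, hq1, hq2⟩ q' ⟨P', hP', hq1', hq2'⟩ a b ha hb hab
    refine ⟨_, hS hP hP' ha hb hab, by simp [hq1, hq1'], ?_⟩
    simp only [Prod.fst_add, Prod.snd_add, Prod.smul_fst, Prod.smul_snd, hE.add_left, hE.smul_left,
      smul_eq_mul]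
    have hr1 : r = a * r + b * r := by rw [← add_mul, hab, one_mul]
    rcases ha.eq_or_lt with rfl | ha
    · have hb1 : b = 1 := by linarith
      subst hb1
      linarith
    · have h1 := mul_lt_mul_of_pos_left hq2 ha
      have h2 := mul_le_mul_of_nonneg_left hq2'.le hb
      linarith
  have hHne : H.Nonempty := by
    obtain ⟨P, hP⟩ := hne
    exact ⟨(P.2, ipE P.1 X - r - 1), P, hP, rfl, by simp only; linarith⟩
  have hH0 : (0 : F × ℝ) ∉ H := by
    rintro ⟨⟨Y, W⟩, hP, h1, h2⟩
    simp only [Prod.fst_zero, Prod.snd_zero] at h1 h2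
    subst h1
    linarith [hr' Y hP]
  obtain ⟨f, hf, q, hq, hfq⟩ := hH.exists_proper_separation hHne hH0
  let g : F →ₗ[ℝ] ℝ := f ∘ₗ LinearMap.inl ℝ F ℝ
  let α : ℝ := f (0, 1)
  have hfg : ∀ w t, f (w, t) = g w + α * t := fun w t => by
    have : (w, t) = LinearMap.inl ℝ F ℝ w + t • ((0 : F), (1 : ℝ)) := by simp
    rw [this, map_add, map_smul, smul_eq_mul, mul_comm]
    rfl
  have hle : ∀ P ∈ S, ∀ s : ℝ, 0 < s → g P.2 + α * (ipE P.1 X - r - s) ≤ 0 := fun P hP s hs => by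
    rw [← hfg]
    exact hf _ ⟨P, hP, rfl, by simp only; linarith⟩
  -- The vertical component of the separator cannot be negative, since `H` is unbounded downwards.
  -- If it were zero, `g ≤ 0` on the projection, and internality would exclude the strict inequality
  -- at `q`.
  have hα : 0 < α := by
    rcases lt_trichotomy α 0 with hα | hα | hα
    · exfalso
      obtain ⟨P, hP⟩ := hne
      have h1 := hle P hP ((|g P.2 + α * (ipE P.1 X - r)| + 1) / (-α))
        (div_pos (by positivity) (by linarith))
      have h2 : α * ((|g P.2 + α * (ipE P.1 X - r)| + 1) / (-α)) =
          -(|g P.2 + α * (ipE P.1 X - r)| + 1) := by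
        rw [div_neg, mul_neg, mul_div_cancel₀ _ hα.ne]
      rw [mul_sub, h2] at h1
      linarith [neg_abs_le (g P.2 + α * (ipE P.1 X - r))]
    · exfalso
      have hg : ∀ w ∈ Prod.snd '' S, g w ≤ 0 := by
        rintro _ ⟨P, hP, rfl⟩
        simpa [hα] using hle P hP 1 one_pos
      obtain ⟨P, hP, hq1, -⟩ := hq
      have hqf : f q = g q.1 + α * q.2 := hfg q.1 q.2
      rw [hα, zero_mul, add_zero, hq1] at hqf
      obtain ⟨ε, hε, hmem⟩ := hint P.2 ⟨P, hP, rfl⟩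
      have h1 := hg _ hmem
      rw [map_neg, map_smul, smul_eq_mul] at h1
      nlinarith
    · exact hα
  obtain ⟨v, hv⟩ := hF.exists_eq g
  -- Normalising the vertical component to 1 turns the separator into the dual multiplier.
  refine infSupp_le_coe (V := α⁻¹ • v) fun P hP => ?_
  refine le_of_forall_pos_le_add fun δ hδ => ?_
  have h1 := mul_le_mul_of_nonneg_left (hle P hP δ hδ) (inv_nonneg.2 hα.le)
  rw [mul_zero, mul_add, ← mul_assoc, inv_mul_cancel₀ hα.ne', one_mul, hv] at h1
  rw [hF.smul_right]
  linarith

variable [TopologicalSpace E] [IsTopologicalAddGroup E] [ContinuousSMul ℝ E] [T2Space E]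
  [FiniteDimensional ℝ E]

/-- The supremum over `X` and the infimum over `V` merge into a joint supremum: the conjugate of the
projection at `Y` is the conjugate of the full support function at `(Y, 0)`. -/
theorem fenchelConj_infSupp (hE : IsInnerProduct ipE) (hF : IsInnerProduct ipF) {S : Set (E × F)}
    (hne : S.Nonempty) (hS : Convex ℝ S) (Y : E) :
    fenchelConj ipE (infSupp ipE ipF S) Y = indicatorFn (closure S) (Y, 0) := by
  rw [← fenchelConj_supportFn (ip := prodIp ipE ipF) (hE.prod hF) hne hS]
  refine EReal.eq_of_forall_le_coe_iff fun r => ?_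
  rw [fenchelConj_le_coe_iff, fenchelConj_le_coe_iff]
  simp [infSupp, le_iInf_iff, prodIp, hF.zero_right]

/-- Strong duality when the infimal projection is finite. -/
theorem infSupp_eq_supportFn_of_finite (hE : IsInnerProduct ipE) (hF : IsInnerProduct ipF)
    {S : Set (E × F)} (hne : S.Nonempty) (hS : Convex ℝ S) (hc : IsClosed S)
    (hfin : ∀ X, infSupp ipE ipF S X < ⊤) (hbot : ∀ X, infSupp ipE ipF S X ≠ ⊥) :
    {Y | (Y, (0 : F)) ∈ S}.Nonempty ∧
      infSupp ipE ipF S = supportFn ipE {Y | (Y, (0 : F)) ∈ S} := by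
  have key : ∀ X₀, ∃ Y, (Y, (0 : F)) ∈ S ∧ infSupp ipE ipF S X₀ = (ipE X₀ Y : EReal) := by
    intro X₀
    obtain ⟨Y, hY, hY0⟩ := exists_linear_le_infSupp hE hF hfin hbot X₀
    refine ⟨Y, ?_, hY0⟩
    -- The linear minorant says that the conjugate at `Y` is at most 0, while off the closed set `S`
    -- the conjugate is `⊤`.
    by_contra hcon
    have h1 : fenchelConj ipE (infSupp ipE ipF S) Y ≤ ((0 : ℝ) : EReal) :=
      fenchelConj_le_coe_iff.2 fun X => by simpa using hY X
    rw [fenchelConj_infSupp hE hF hne hS, hc.closure_eq, indicatorFn, if_neg hcon] at h1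
    simp at h1
  refine ⟨(key 0).imp fun Y hY => hY.1, funext fun X => ?_⟩
  refine le_antisymm ?_ (supportFn_section_le_infSupp hF S X)
  obtain ⟨Y, hY, hYX⟩ := key X
  rw [hYX, hE.symm]
  exact le_supportFn (S := {Y | (Y, (0 : F)) ∈ S}) hY X

end InfimalProjection

/-! ### The Frobenius product and quadratic forms of symmetric matrices. -/

section Frobenius

variable {n m : ℕ}

theorem frob_eq_sum (X Y : Matrix (Fin n) (Fin m) ℝ) : frob X Y = ∑ j, ∑ i, X i j * Y i j := by
  simp [frob, Matrix.trace, Matrix.mul_apply]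

theorem isInnerProduct_frob : IsInnerProduct (frob (n := n) (m := m)) where
  add_left x y z := by simp [frob, Matrix.add_mul]
  smul_left c x z := by simp [frob]
  symm x y := by simp only [frob_eq_sum, mul_comm]
  pos x hx := by
    rw [frob_eq_sum]
    have hnn : ∀ j, 0 ≤ ∑ i, x i j * x i j := fun j =>
      Finset.sum_nonneg fun i _ => mul_self_nonneg _
    refine lt_of_le_of_ne (Finset.sum_nonneg fun j _ => hnn j) fun h => hx ?_
    ext i j
    have h1 := (Finset.sum_eq_zero_iff_of_nonneg fun j _ => hnn j).1 h.symm j (Finset.mem_univ j)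
    have h2 := (Finset.sum_eq_zero_iff_of_nonneg fun i _ => mul_self_nonneg _).1 h1 i
      (Finset.mem_univ i)
    simpa using h2

theorem isInnerProduct_frobSym : IsInnerProduct (frobSym (n := n)) where
  add_left _ _ _ := isInnerProduct_frob.add_left _ _ _
  smul_left _ _ _ := isInnerProduct_frob.smul_left _ _ _
  symm _ _ := isInnerProduct_frob.symm _ _
  pos _ hx := isInnerProduct_frob.pos _ fun h => hx (Subtype.ext h)

/-- The symmetric bilinear form `(Y, Z) ↦ tr (Yᵀ V Z)` of a symmetric matrix `V`. -/
def frobForm (V : SymMat n) (Y Z : Matrix (Fin n) (Fin m) ℝ) : ℝ :=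
  frob Y ((V : Matrix (Fin n) (Fin n) ℝ) * Z)

theorem frobForm_comm (V : SymMat n) (Y Z : Matrix (Fin n) (Fin m) ℝ) :
    frobForm V Y Z = frobForm V Z Y := by
  have hV : (V : Matrix (Fin n) (Fin n) ℝ)ᵀ = V := V.2
  rw [frobForm, frobForm, isInnerProduct_frob.symm, frob, frob, Matrix.transpose_mul, hV,
    Matrix.mul_assoc]

theorem frobForm_add_left (V : SymMat n) (Y Y' Z : Matrix (Fin n) (Fin m) ℝ) :
    frobForm V (Y + Y') Z = frobForm V Y Z + frobForm V Y' Z :=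
  isInnerProduct_frob.add_left _ _ _

theorem frobForm_smul_left (V : SymMat n) (c : ℝ) (Y Z : Matrix (Fin n) (Fin m) ℝ) :
    frobForm V (c • Y) Z = c * frobForm V Y Z :=
  isInnerProduct_frob.smul_left _ _ _

theorem frobForm_add_smul_self (V : SymMat n) (a b : ℝ) (Y Z : Matrix (Fin n) (Fin m) ℝ) :
    frobForm V (a • Y + b • Z) (a • Y + b • Z) =
      a ^ 2 * frobForm V Y Y + 2 * a * b * frobForm V Y Z + b ^ 2 * frobForm V Z Z := by
  have hr : ∀ W, frobForm V W (a • Y + b • Z) = a * frobForm V Y W + b * frobForm V Z W :=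
    fun W => by rw [frobForm_comm, frobForm_add_left, frobForm_smul_left, frobForm_smul_left]
  rw [hr, frobForm_comm V _ Y, frobForm_comm V _ Z, hr, hr, frobForm_comm V Z Y]
  ring

theorem frobSym_halfGram (Y : Matrix (Fin n) (Fin m) ℝ) (V : SymMat n) :
    frobSym (halfGram Y) V = 1 / 2 * frobForm V Y Y := by
  simp only [frobSym, halfGram, frobForm, frob]
  rw [Matrix.transpose_smul, Matrix.transpose_mul, Matrix.transpose_transpose, Matrix.smul_mul,
    Matrix.trace_smul, Matrix.mul_assoc, Matrix.trace_mul_comm, smul_eq_mul, Matrix.mul_assoc]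

theorem continuous_halfGram : Continuous (halfGram (n := n) (m := m)) := by
  refine Continuous.subtype_mk ?_ _
  fun_prop

theorem frobForm_self_eq_sum (V : SymMat n) (Y : Matrix (Fin n) (Fin m) ℝ) :
    frobForm V Y Y =
      ∑ j, Y.col j ⬝ᵥ ((V : Matrix (Fin n) (Fin n) ℝ) *ᵥ Y.col j) := by
  simp [frobForm, frob_eq_sum, Matrix.mul_apply, dotProduct, Matrix.mulVec, Matrix.col]

/-- The only possibly nonzero column of this matrix is `u`. Having one column available (`m ≥ 1`)
lets matrix arguments test the quadratic form on any vector. -/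
theorem frobForm_vecMulVec_single (V : SymMat n) (u : Fin n → ℝ) (j₀ : Fin m) :
    frobForm V (Matrix.vecMulVec u (Pi.single j₀ 1)) (Matrix.vecMulVec u (Pi.single j₀ 1)) =
      u ⬝ᵥ ((V : Matrix (Fin n) (Fin n) ℝ) *ᵥ u) := by
  rw [frobForm_self_eq_sum, Finset.sum_eq_single j₀]
  · have : (Matrix.vecMulVec u (Pi.single j₀ (1 : ℝ))).col j₀ = u := by
      ext i; simp [Matrix.col, Matrix.vecMulVec_apply]
    rw [this]
  · intro j _ hj
    have : (Matrix.vecMulVec u (Pi.single j₀ (1 : ℝ))).col j = 0 := by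
      ext i; simp [Matrix.col, Matrix.vecMulVec_apply, hj]
    rw [this]
    simp
  · simp

end Frobenius

/-! ### The cone 𝒦_A and its interior. -/

section ConeK

variable {l n m : ℕ} {A : Matrix (Fin l) (Fin n) ℝ}

theorem frobForm_nonneg_of_mem_coneK {V : SymMat n} (hV : V ∈ coneK A)
    {N : Matrix (Fin n) (Fin m) ℝ} (hN : A * N = 0) : 0 ≤ frobForm V N N := by
  rw [frobForm_self_eq_sum]
  refine Finset.sum_nonneg fun j _ => hV _ ?_
  ext i
  have := congrFun (congrFun hN i) j
  simpa [Matrix.mul_apply, Matrix.mulVec, dotProduct, Matrix.col] using this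

theorem smul_mem_coneK (t : ℝ) (ht : 0 ≤ t) (V : SymMat n) (hV : V ∈ coneK A) :
    t • V ∈ coneK A := by
  intro u hu
  simpa [Matrix.smul_mulVec] using mul_nonneg ht (hV u hu)

theorem convex_coneK : Convex ℝ (coneK A) := by
  intro V hV W hW a b ha hb _ u hu
  have h1 := smul_mem_coneK a ha V hV u hu
  have h2 := smul_mem_coneK b hb W hW u hu
  simpa [Matrix.add_mulVec] using add_nonneg h1 h2

theorem mem_polarSet_coneK {W : SymMat n} :
    W ∈ polarSet frobSym (coneK A) ↔ ∀ V ∈ coneK A, frobSym W V ≤ 0 :=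
  mem_polarSet_iff_of_cone isInnerProduct_frobSym smul_mem_coneK

/-- The identity matrix as an element of the space of symmetric matrices. -/
def symOne (n : ℕ) : SymMat n := ⟨1, Matrix.isSymm_one⟩

/-- By Cauchy–Schwarz, `(∑|u i|)² ≤ n ∑ (u i)²`, so an entrywise perturbation below `1/(n+1)`
changes the identity's form by at most `∑ (u i)²`. -/
theorem symOne_mem_interior_coneK : symOne n ∈ interior (coneK A) := by
  have hopen : IsOpen {V : SymMat n | ∀ i j, |V.1 i j - (1 : Matrix (Fin n) (Fin n) ℝ) i j| <
      1 / ((n : ℝ) + 1)} := by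
    simp only [Set.ofPred_forall]
    refine isOpen_iInter_of_finite fun i => isOpen_iInter_of_finite fun j =>
      isOpen_lt ?_ continuous_const
    have : Continuous fun V : SymMat n => V.1 i j :=
      (continuous_apply_apply i j).comp continuous_subtype_val
    exact (this.sub continuous_const).abs
  refine mem_interior.2 ⟨_, ?_, hopen, fun i j => ?_⟩
  · intro V hV u _
    have hpos : (0 : ℝ) < (n : ℝ) + 1 := by positivity
    let D : Matrix (Fin n) (Fin n) ℝ := V.1 - 1
    have hD : V.1 = 1 + D := by simp [D]
    have h1 : u ⬝ᵥ (V.1 *ᵥ u) = ∑ i, u i ^ 2 + ∑ i, ∑ j, u i * (D i j * u j) := by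
      rw [hD, Matrix.add_mulVec, Matrix.one_mulVec, dotProduct_add]
      congr 1
      · simp [dotProduct, sq]
      · simp [dotProduct, Matrix.mulVec, Finset.mul_sum]
    have h2 : ∀ i j, -(1 / ((n : ℝ) + 1) * (|u i| * |u j|)) ≤ u i * (D i j * u j) := fun i j => by
      have h3 : |u i * (D i j * u j)| ≤ 1 / ((n : ℝ) + 1) * (|u i| * |u j|) := by
        rw [abs_mul, abs_mul, mul_left_comm]
        exact mul_le_mul_of_nonneg_right (hV i j).le (by positivity)
      linarith [neg_abs_le (u i * (D i j * u j))]
    have h3 : -(1 / ((n : ℝ) + 1) * (∑ i, |u i|) ^ 2) ≤ ∑ i, ∑ j, u i * (D i j * u j) := by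
      rw [sq, Finset.sum_mul_sum, Finset.mul_sum, ← Finset.sum_neg_distrib]
      refine Finset.sum_le_sum fun i _ => ?_
      rw [Finset.mul_sum, ← Finset.sum_neg_distrib]
      exact Finset.sum_le_sum fun j _ => h2 i j
    have h4 : (∑ i, |u i|) ^ 2 ≤ n * ∑ i, u i ^ 2 := by
      simpa using sq_sum_le_card_mul_sum_sq (s := Finset.univ) (f := fun i => |u i|)
    have h5 : (0 : ℝ) ≤ ∑ i, u i ^ 2 := Finset.sum_nonneg fun i _ => sq_nonneg _
    have h6 : 1 / ((n : ℝ) + 1) * (∑ i, |u i|) ^ 2 ≤ ∑ i, u i ^ 2 := by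
      rw [one_div_mul_eq_div, div_le_iff₀ hpos]
      linarith
    rw [h1]
    linarith
  · simp only [symOne, sub_self, abs_zero]
    positivity

/-- The direction `Z` is arbitrary: the identity gives coercivity on ker A, and a horizon direction
of 𝒱 gives the triviality of `𝒱^∞ ∩ (-𝒦_A°)`. -/
theorem exists_sub_smul_symOne_mem_coneK {V : SymMat n} (hV : V ∈ interior (coneK A)) (Z : SymMat n) :
    ∃ ε : ℝ, 0 < ε ∧ V - ε • Z ∈ coneK A := by
  have hc : Continuous fun ε : ℝ => V - ε • Z := by fun_prop
  have hev : ∀ᶠ ε in 𝓝 (0 : ℝ), V - ε • Z ∈ interior (coneK A) :=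
    hc.continuousAt.eventually_mem (by simpa using isOpen_interior.mem_nhds hV)
  obtain ⟨δ, hδ, hball⟩ := Metric.eventually_nhds_iff.1 hev
  refine ⟨δ / 2, by positivity, interior_subset (s := coneK A) (hball (y := δ / 2) ?_)⟩
  rw [Real.dist_eq, sub_zero, abs_of_pos (by positivity)]
  linarith

theorem exists_coercive_of_mem_interior_coneK {V : SymMat n} (hV : V ∈ interior (coneK A)) :
    ∃ ε : ℝ, 0 < ε ∧ ∀ N : Matrix (Fin n) (Fin m) ℝ, A * N = 0 →
      ε * frob N N ≤ frobForm V N N := by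
  obtain ⟨ε, hε, hmem⟩ := exists_sub_smul_symOne_mem_coneK hV (symOne n)
  refine ⟨ε, hε, fun N hN => ?_⟩
  have h1 := frobForm_nonneg_of_mem_coneK hmem hN
  have h2 : frobForm (V - ε • symOne n) N N = frobForm V N N - ε * frob N N := by
    simp only [frobForm, symOne, Submodule.coe_sub, Submodule.coe_smul, Matrix.sub_mul,
      Matrix.smul_mul, Matrix.one_mul, isInnerProduct_frob.sub_right,
      isInnerProduct_frob.smul_right]
  linarith

end ConeK

/-! ### The sets Ω and Σ, and the projection as an infimal support function. -/

section Sets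

variable {l n m : ℕ} {A : Matrix (Fin l) (Fin n) ℝ} {B : Matrix (Fin l) (Fin m) ℝ}

theorem exists_mul_eq_of_range_le
    (hAB : LinearMap.range B.mulVecLin ≤ LinearMap.range A.mulVecLin) :
    ∃ Y : Matrix (Fin n) (Fin m) ℝ, A * Y = B := by
  have h : ∀ j, ∃ y, A *ᵥ y = B *ᵥ Pi.single j 1 := fun j =>
    hAB ⟨Pi.single j 1, rfl⟩
  choose y hy using h
  refine ⟨Matrix.of fun i j => y j i, ?_⟩
  ext i j
  have := congrFun (hy j) i
  simpa [Matrix.mulVec, dotProduct, Matrix.mul_apply, Pi.single_apply] using this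

theorem graphD_subset_setOmega : graphD A B ⊆ setOmega A B := by
  rintro P ⟨h1, h2⟩
  refine ⟨h1, ?_⟩
  rw [h2, add_neg_cancel, mem_polarSet_coneK]
  intro V _
  rw [isInnerProduct_frobSym.zero_left]

/-- Differences of solutions of `A * Y = B` lie in ker A, where `V` in the cone is nonnegative.
Hence `Y ↦ ⟨½YYᵀ, V⟩` is convex on the solution set. -/
theorem convex_setOmega : Convex ℝ (setOmega A B) := by
  rintro ⟨Y, W⟩ ⟨hY, hW⟩ ⟨Y', W'⟩ ⟨hY', hW'⟩ a b ha hb hab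
  simp only at hY hW hY' hW'
  refine ⟨?_, ?_⟩
  · simp [Matrix.mul_add, hY, hY', ← add_smul, hab]
  · rw [mem_polarSet_coneK] at hW hW' ⊢
    intro V hV
    have hN : A * ((1 : ℝ) • Y + (-1 : ℝ) • Y') = 0 := by simp [Matrix.mul_add, hY, hY']
    have h0 := frobForm_nonneg_of_mem_coneK hV hN
    have h1 := hW V hV
    have h2 := hW' V hV
    simp only [Prod.smul_mk, Prod.mk_add_mk, isInnerProduct_frobSym.add_left,
      isInnerProduct_frobSym.smul_left, frobSym_halfGram, frobForm_add_smul_self] at h0 h1 h2 ⊢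
    obtain rfl : b = 1 - a := by linarith
    nlinarith [mul_le_mul_of_nonneg_left h1 ha, mul_le_mul_of_nonneg_left h2 hb,
      mul_nonneg (mul_nonneg ha hb) h0]

/-- A kernel vector of negative curvature gives a line `Y₀ + t N` of solutions along which the
objective is a quadratic in `t` with positive leading coefficient. -/
theorem gmf_eq_top (hm : 0 < m) {Y₀ : Matrix (Fin n) (Fin m) ℝ} (hY₀ : A * Y₀ = B)
    (X : Matrix (Fin n) (Fin m) ℝ) {V : SymMat n} (hV : V ∉ coneK A) : gmf A B (X, V) = ⊤ := by
  by_contra hne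
  obtain ⟨r, hr⟩ := EReal.lt_top_iff_exists_le_coe.1 (lt_top_iff_ne_top.2 hne)
  have hr' := supportFn_le_coe_iff.1 hr
  simp only [coneK, Set.mem_ofPred_eq, not_forall, not_le] at hV
  obtain ⟨u, hu, hneg⟩ := hV
  let N : Matrix (Fin n) (Fin m) ℝ := Matrix.vecMulVec u (Pi.single ⟨0, hm⟩ 1)
  have hAN : A * N = 0 := by
    rw [Matrix.mul_vecMulVec, hu, Matrix.zero_vecMulVec]
  have hNN : frobForm V N N < 0 := (frobForm_vecMulVec_single V u _).trans_lt hneg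
  have key : ∀ t : ℝ, (frob Y₀ X - 1 / 2 * frobForm V Y₀ Y₀ - r) +
      t * (frob N X - frobForm V Y₀ N) + t ^ 2 * (-(1 / 2) * frobForm V N N) ≤ 0 := fun t => by
    have h1 := hr' ((1 : ℝ) • Y₀ + t • N, -halfGram ((1 : ℝ) • Y₀ + t • N))
      ⟨by simp [Matrix.mul_add, hY₀, hAN], rfl⟩
    simp only [frobPair, isInnerProduct_frobSym.neg_left, frobSym_halfGram,
      frobForm_add_smul_self, isInnerProduct_frob.add_left, isInnerProduct_frob.smul_left] at h1
    linarith
  generalize frob Y₀ X - 1 / 2 * frobForm V Y₀ Y₀ - r = a at key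
  generalize frob N X - frobForm V Y₀ N = b at key
  have hc : 0 < -(1 / 2) * frobForm V N N := by linarith
  generalize -(1 / 2) * frobForm V N N = c at key hc
  -- For this `t` one has `c t = c + |a| + |b|` and `t ≥ 1`, so the quadratic term outweighs both
  -- lower-order terms.
  have ht := key (1 + (|a| + |b|) / c)
  have hct : c * (1 + (|a| + |b|) / c) = c + |a| + |b| := by field_simp; ring
  have ht1 : 1 ≤ 1 + (|a| + |b|) / c := by
    have : 0 ≤ (|a| + |b|) / c := by positivity
    linarith
  generalize 1 + (|a| + |b|) / c = t at ht hct ht1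
  have h1 : t ^ 2 * c = (c + |a| + |b|) * t := by rw [← hct]; ring
  rw [h1] at ht
  nlinarith [neg_abs_le a, mul_nonneg (by linarith [neg_abs_le b] : 0 ≤ |b| + b)
    (by linarith : 0 ≤ t), mul_nonneg (by positivity : 0 ≤ c + |a|) (by linarith : 0 ≤ t - 1)]

theorem gmf_eq_supportFn_setOmega (hm : 0 < m) {Y₀ : Matrix (Fin n) (Fin m) ℝ} (hY₀ : A * Y₀ = B) :
    gmf A B = supportFn frobPair (setOmega A B) := by
  funext ⟨X, V⟩
  refine le_antisymm (iSup₂_le fun P hP => le_supportFn (graphD_subset_setOmega hP) _) ?_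
  by_cases hV : V ∈ coneK A
  · refine iSup₂_le fun P hP => ?_
    refine le_trans ?_ (le_supportFn (S := graphD A B) (v := (P.1, -halfGram P.1)) ⟨hP.1, rfl⟩ _)
    have h1 := mem_polarSet_coneK.1 hP.2 V hV
    rw [isInnerProduct_frobSym.add_left] at h1
    simp only [frobPair, EReal.coe_le_coe_iff, isInnerProduct_frobSym.neg_left]
    linarith
  · rw [gmf_eq_top hm hY₀ X hV]
    exact le_top

variable {𝒱 : Set (SymMat n)}

theorem mem_setSigma_iff {Y : Matrix (Fin n) (Fin m) ℝ} {W : SymMat n} :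
    (Y, W) ∈ setSigma A B 𝒱 ↔
      A * Y = B ∧ halfGram Y + W ∈ 𝒱 + polarSet frobSym (coneK A) := by
  constructor
  · rintro ⟨⟨Y', U⟩, hP, ⟨Z, v⟩, ⟨hZ, hv⟩, hsum⟩
    obtain rfl : Z = 0 := hZ
    simp only [Prod.mk_add_mk, add_zero, Prod.mk.injEq] at hsum
    obtain ⟨rfl, rfl⟩ := hsum
    exact ⟨hP.1, v, hv, _, hP.2, by simp only; abel⟩
  · rintro ⟨hY, v, hv, κ, hκ, hsum⟩
    simp only at hsum
    refine ⟨(Y, W - v), ⟨hY, ?_⟩, (0, v), ⟨rfl, hv⟩, by simp⟩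
    have : halfGram Y + (W - v) = κ := by rw [← add_sub_assoc, ← hsum]; abel
    simpa only [this] using hκ

theorem convex_setSigma (hconv : Convex ℝ 𝒱) : Convex ℝ (setSigma A B 𝒱) :=
  convex_setOmega.add ((convex_singleton 0).prod hconv)

theorem setOmega_nonempty {Y₀ : Matrix (Fin n) (Fin m) ℝ} (hY₀ : A * Y₀ = B) :
    (setOmega A B).Nonempty :=
  ⟨(Y₀, -halfGram Y₀), graphD_subset_setOmega ⟨hY₀, rfl⟩⟩

theorem setSigma_nonempty {Y₀ : Matrix (Fin n) (Fin m) ℝ} (hY₀ : A * Y₀ = B)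
    (hne : 𝒱.Nonempty) : (setSigma A B 𝒱).Nonempty :=
  (setOmega_nonempty hY₀).add ((Set.singleton_nonempty 0).prod hne)

theorem image_snd_setSigma : Prod.snd '' setSigma A B 𝒱 = setOmega₂ A B + 𝒱 := by
  ext W
  constructor
  · rintro ⟨_, ⟨P, hP, Q, hQ, rfl⟩, rfl⟩
    exact ⟨P.2, ⟨P.1, hP⟩, Q.2, hQ.2, rfl⟩
  · rintro ⟨U, ⟨Y, hY⟩, v, hv, rfl⟩
    exact ⟨(Y, U) + (0, v), Set.add_mem_add hY ⟨rfl, hv⟩, rfl⟩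

/-- Σ is the part of `A Y = B` on which the continuous map `(Y, W) ↦ ½YYᵀ + W` takes values in `𝒱 +
𝒦_A°`; the horizon condition closes that sum. -/
theorem isClosed_setSigma (hcl : IsClosed 𝒱)
    (h : horizonCone 𝒱 ∩ (-polarSet frobSym (coneK A)) ⊆ {0}) : IsClosed (setSigma A B 𝒱) := by
  have hsum : IsClosed (𝒱 + polarSet frobSym (coneK A)) := by
    refine isClosed_add_of_horizonCone hcl (isClosed_polarSet isInnerProduct_frobSym _) ?_ h
    intro t ht W hW
    rw [mem_polarSet_coneK] at hW ⊢
    intro V hV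
    rw [isInnerProduct_frobSym.smul_left]
    exact mul_nonpos_of_nonneg_of_nonpos ht.le (hW V hV)
  have heq : setSigma A B 𝒱 = {P : PairSpace n m | A * P.1 = B} ∩
      (fun P : PairSpace n m => halfGram P.1 + P.2) ⁻¹' (𝒱 + polarSet frobSym (coneK A)) := by
    ext ⟨Y, W⟩
    exact mem_setSigma_iff
  rw [heq]
  refine IsClosed.inter (isClosed_eq ?_ continuous_const) (hsum.preimage ?_)
  · fun_prop
  · exact (continuous_halfGram.comp continuous_fst).add continuous_snd

theorem infProj_eq_infSupp (hm : 0 < m) {Y₀ : Matrix (Fin n) (Fin m) ℝ} (hY₀ : A * Y₀ = B)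
    (hne : 𝒱.Nonempty) :
    infProj A B (supportFn frobSym 𝒱) = infSupp frob frobSym (setSigma A B 𝒱) := by
  funext X
  refine iInf_congr fun V => ?_
  rw [gmf_eq_supportFn_setOmega hm hY₀]
  refine EReal.eq_of_forall_le_coe_iff fun r => ?_
  rw [supportFn_le_coe_iff]
  constructor
  · rintro h _ ⟨P, hP, Q, hQ, rfl⟩
    have hQ1 : Q.1 = 0 := hQ.1
    have h1 := (add_le_add (le_supportFn (ip := frobPair) hP (X, V))
      (le_supportFn (ip := frobSym) hQ.2 V)).trans h
    rw [← EReal.coe_add, EReal.coe_le_coe_iff] at h1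
    simp only [frobPair, prodIp, Prod.fst_add, Prod.snd_add, hQ1, add_zero,
      isInnerProduct_frobSym.add_left] at h1 ⊢
    linarith
  · intro h
    have h1 : ∀ P ∈ setOmega A B, ∀ v ∈ 𝒱, frobPair P (X, V) + frobSym v V ≤ r := by
      intro P hP v hv
      have := h _ (Set.add_mem_add hP (show (0, v) ∈ _ from ⟨rfl, hv⟩))
      simp only [prodIp, Prod.fst_add, Prod.snd_add, add_zero,
        isInnerProduct_frobSym.add_left] at this
      simp only [frobPair]
      linarith
    obtain ⟨v₀, hv₀⟩ := hne
    -- One fixed element of 𝒱 makes the support value of Ω real, so it can be subtracted to bound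
    -- that of 𝒱.
    have htop : supportFn frobPair (setOmega A B) (X, V) ≠ ⊤ :=
      (EReal.lt_top_iff_exists_le_coe.2 ⟨r - frobSym v₀ V, supportFn_le_coe_iff.2 fun P hP => by
        linarith [h1 P hP v₀ hv₀]⟩).ne
    have hbot := supportFn_ne_bot (ip := frobPair) (setOmega_nonempty hY₀) (X, V)
    lift supportFn frobPair (setOmega A B) (X, V) to ℝ using ⟨htop, hbot⟩ with a ha
    have h2 : supportFn frobSym 𝒱 V ≤ ((r - a : ℝ) : EReal) := supportFn_le_coe_iff.2 fun v hv => by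
      have : supportFn frobPair (setOmega A B) (X, V) ≤ ((r - frobSym v V : ℝ) : EReal) :=
        supportFn_le_coe_iff.2 fun P hP => by linarith [h1 P hP v hv]
      rw [← ha, EReal.coe_le_coe_iff] at this
      linarith
    refine (add_le_add_right h2 _).trans ?_
    rw [← EReal.coe_add, EReal.coe_le_coe_iff]
    linarith

/-- Writing `Y = Y₀ + N` with `A N = 0`, coercivity at this `V` makes the objective a concave
quadratic in `N` up to bounded terms. -/
theorem infSupp_setSigma_lt_top {Y₀ : Matrix (Fin n) (Fin m) ℝ} (hY₀ : A * Y₀ = B) {V : SymMat n}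
    (hV : V ∈ barrierCone frobSym 𝒱) (hVK : V ∈ interior (coneK A))
    (X : Matrix (Fin n) (Fin m) ℝ) : infSupp frob frobSym (setSigma A B 𝒱) X < ⊤ := by
  obtain ⟨r, hr⟩ := mem_barrierCone_iff.1 hV
  obtain ⟨ε, hε, hco⟩ := exists_coercive_of_mem_interior_coneK (m := m) hVK
  let G := X - (V : Matrix (Fin n) (Fin n) ℝ) * Y₀
  refine EReal.lt_top_iff_exists_le_coe.2
    ⟨r + frob Y₀ X - 1 / 2 * frobForm V Y₀ Y₀ + frob G G / (2 * ε),
      infSupp_le_coe (V := V) ?_⟩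
  rintro _ ⟨⟨Y, W⟩, hP, Q, hQ, rfl⟩
  have hQ1 : Q.1 = 0 := hQ.1
  have h1 := mem_polarSet_coneK.1 hP.2 V (interior_subset hVK)
  have h2 := hr _ hQ.2
  obtain ⟨N, rfl⟩ : ∃ N, Y = (1 : ℝ) • Y₀ + (1 : ℝ) • N := ⟨Y - Y₀, by simp⟩
  have hN : A * N = 0 := by
    have := hP.1
    simpa [Matrix.mul_add, hY₀] using this
  have h3 := hco N hN
  have h4 : frob N G = frob N X - frobForm V Y₀ N := by
    rw [isInnerProduct_frob.sub_right, frobForm_comm]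
    rfl
  -- Completing the square, that is, expanding the nonnegative square of `ε • N - G`.
  have h5 : frob N G - ε / 2 * frob N N ≤ frob G G / (2 * ε) := by
    rw [le_div_iff₀ (by positivity)]
    have := isInnerProduct_frob.self_nonneg (ε • N - G)
    rw [sub_eq_add_neg, isInnerProduct_frob.add_left, isInnerProduct_frob.add_right,
      isInnerProduct_frob.add_right, isInnerProduct_frob.neg_left, isInnerProduct_frob.neg_left,
      isInnerProduct_frob.neg_right, isInnerProduct_frob.neg_right, isInnerProduct_frob.smul_left,
      isInnerProduct_frob.smul_right, isInnerProduct_frob.smul_left,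
      isInnerProduct_frob.smul_right, isInnerProduct_frob.symm G N] at this
    linarith
  simp only [Prod.fst_add, Prod.snd_add, hQ1, add_zero, isInnerProduct_frobSym.add_left,
    isInnerProduct_frob.add_left, isInnerProduct_frob.smul_left, frobSym_halfGram,
    frobForm_add_smul_self] at h1 ⊢
  linarith

/-- If only the zero matrix is feasible, the infimal projection is the support function of an
affine subspace. -/
theorem infProj_eq_supportFn_of_trivial (hm : 0 < m) {Y₀ : Matrix (Fin n) (Fin m) ℝ}
    (hY₀ : A * Y₀ = B) (hne : 𝒱.Nonempty) (h : barrierCone frobSym 𝒱 ∩ coneK A ⊆ {0}) :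
    infProj A B (supportFn frobSym 𝒱) = supportFn frob {Y | A * Y = B} := by
  have h0 : ∀ X, gmf A B (X, 0) + supportFn frobSym 𝒱 0 = supportFn frob {Y | A * Y = B} X := by
    intro X
    rw [supportFn_zero isInnerProduct_frobSym hne, add_zero]
    refine EReal.eq_of_forall_le_coe_iff fun r => ?_
    rw [gmf, supportFn_le_coe_iff, supportFn_le_coe_iff]
    constructor
    · intro hP Y hY
      simpa [frobPair, isInnerProduct_frobSym.zero_right] using hP (Y, -halfGram Y) ⟨hY, rfl⟩
    · intro hY P hP
      simpa [frobPair, isInnerProduct_frobSym.zero_right] using hY P.1 hP.1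
  funext X
  refine le_antisymm ((iInf_le _ 0).trans_eq (h0 X)) (le_iInf fun V => ?_)
  by_cases hV : V = 0
  · rw [hV, h0]
  refine le_top.trans_eq (Eq.symm ?_)
  by_cases hVK : V ∈ coneK A
  · have hVb : V ∉ barrierCone frobSym 𝒱 := fun hb => hV (h ⟨hb, hVK⟩)
    have : supportFn frobSym 𝒱 V = ⊤ := not_lt_top_iff.1 hVb
    rw [this]
    refine EReal.add_top_of_ne_bot ?_
    exact supportFn_ne_bot (S := graphD A B) ⟨(Y₀, -halfGram Y₀), hY₀, rfl⟩ _
  · rw [gmf_eq_top hm hY₀ X hVK]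
    exact EReal.top_add_of_ne_bot (supportFn_ne_bot hne V)

end Sets

/-! ### The qualification conditions and the theorem. -/

section MainResult

/-- The span contains `-w`, so `-w = t • x` with `x` in `C`, and `ε = t⁻¹` works. If `t = 0` then `w
= 0`. -/
theorem exists_pos_neg_smul_mem_of_posHull_eq_span {E : Type*} [AddCommGroup E] [Module ℝ E]
    {C : Set E} (h : posHull C = (Submodule.span ℝ C : Set E)) {w : E} (hw : w ∈ C) :
    ∃ ε : ℝ, 0 < ε ∧ -(ε • w) ∈ C := by
  have hneg : -w ∈ posHull C := by
    rw [h]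
    exact neg_mem (Submodule.subset_span hw)
  obtain ⟨t, ht, x, hx, hwx⟩ := hneg
  rcases ht.eq_or_lt with rfl | ht
  · rw [zero_smul, neg_eq_zero] at hwx
    exact ⟨1, one_pos, by simpa [hwx] using hw⟩
  · refine ⟨t⁻¹, inv_pos.2 ht, ?_⟩
    rw [← smul_neg, hwx, smul_smul, inv_mul_cancel₀ ht.ne', one_smul]
    exact hx

variable {l n m : ℕ} {A : Matrix (Fin l) (Fin n) ℝ} {B : Matrix (Fin l) (Fin m) ℝ}
  {𝒱 : Set (SymMat n)}

theorem effDomain_fenchelConj_supportFn (hne : 𝒱.Nonempty) (hcl : IsClosed 𝒱)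
    (hconv : Convex ℝ 𝒱) : effDomain (fenchelConj frobSym (supportFn frobSym 𝒱)) = 𝒱 := by
  rw [fenchelConj_supportFn isInnerProduct_frobSym hne hconv, effDomain_indicatorFn, hcl.closure_eq]

theorem setXi_eq (hne : 𝒱.Nonempty) (hcl : IsClosed 𝒱) (hconv : Convex ℝ 𝒱) :
    setXi A B (supportFn frobSym 𝒱) = {Y | (Y, (0 : SymMat n)) ∈ setSigma A B 𝒱} := by
  ext Y
  rw [setXi, effDomain_fenchelConj_supportFn hne hcl hconv, Set.mem_ofPred_eq, Set.mem_ofPred_eq,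
    mem_setSigma_iff, add_zero]

theorem internal_image_snd_setSigma (hne : 𝒱.Nonempty) (hcl : IsClosed 𝒱) (hconv : Convex ℝ 𝒱)
    (h : PCQ A B (supportFn frobSym 𝒱) ∨
      posHull (setOmega₂ A B + 𝒱) = (Submodule.span ℝ (setOmega₂ A B + 𝒱) : Set (SymMat n))) :
    ∀ w ∈ Prod.snd '' setSigma A B 𝒱, ∃ ε : ℝ, 0 < ε ∧ -(ε • w) ∈ Prod.snd '' setSigma A B 𝒱 := by
  rw [image_snd_setSigma]
  intro w hw
  rcases h with h | h
  · rw [PCQ, effDomain_fenchelConj_supportFn hne hcl hconv] at h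
    exact exists_pos_neg_smul_mem_of_mem_intrinsicInterior h hw
  · exact exists_pos_neg_smul_mem_of_posHull_eq_span h hw

/-- The intersection is a cone, and a nonzero element could be rescaled to norm `|c| + 1`. -/
theorem barrierCone_inter_coneK_subset_of_isNormBounded
    (h : IsNormBounded frobSym (barrierCone frobSym 𝒱 ∩ coneK A)) :
    barrierCone frobSym 𝒱 ∩ coneK A ⊆ {0} := by
  rintro V ⟨hb, hK⟩
  obtain ⟨c, hc⟩ := h
  refine isInnerProduct_frobSym.eq_zero (not_lt.1 fun hpos => ?_)
  have hs : 0 < √(frobSym V V) := Real.sqrt_pos.2 hpos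
  have ht : 0 ≤ (|c| + 1) / √(frobSym V V) := by positivity
  have h1 := hc _ ⟨smul_mem_barrierCone isInnerProduct_frobSym hb ht, smul_mem_coneK _ ht V hK⟩
  rw [isInnerProduct_frobSym.smul_left, isInnerProduct_frobSym.smul_right, ← mul_assoc,
    Real.sqrt_mul (mul_self_nonneg _), Real.sqrt_mul_self ht, div_mul_cancel₀ _ hs.ne'] at h1
  linarith [le_abs_self c]

/-- Split `V` itself as `w + κ` and pair with `V`: both summands contribute nonpositively, so `⟨V,
V⟩ ≤ 0`. -/
theorem barrierCone_inter_coneK_subset_of_horizonCone_add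
    (h : horizonCone 𝒱 + polarSet frobSym (coneK A) = Set.univ) :
    barrierCone frobSym 𝒱 ∩ coneK A ⊆ {0} := by
  rintro V ⟨hb, hK⟩
  obtain ⟨w, hw, κ, hκ, hsum⟩ : V ∈ horizonCone 𝒱 + polarSet frobSym (coneK A) :=
    h ▸ Set.mem_univ V
  simp only at hsum
  have h1 := ip_nonpos_of_mem_horizonCone isInnerProduct_frobSym hw (subset_closure hb)
  have h2 := mem_polarSet_coneK.1 hκ V hK
  refine isInnerProduct_frobSym.eq_zero ?_
  calc frobSym V V = frobSym (w + κ) V := by rw [hsum]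
    _ ≤ 0 := by rw [isInnerProduct_frobSym.add_left]; linarith

/-- Since `V - ε W` stays in 𝒦_A, pairing with `-W` gives `ε⟨W, W⟩ ≤ ⟨W, V⟩ ≤ 0`. -/
theorem horizonCone_inter_subset_of_barrierCone_inter_interior
    (h : (barrierCone frobSym 𝒱 ∩ interior (coneK A)).Nonempty) :
    horizonCone 𝒱 ∩ (-polarSet frobSym (coneK A)) ⊆ {0} := by
  rintro W ⟨hW, hWK⟩
  obtain ⟨V, hV, hVK⟩ := h
  obtain ⟨ε, hε, hmem⟩ := exists_sub_smul_symOne_mem_coneK hVK W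
  have h1 := ip_nonpos_of_mem_horizonCone isInnerProduct_frobSym hW (subset_closure hV)
  have h2 := mem_polarSet_coneK.1 hWK _ hmem
  rw [isInnerProduct_frobSym.neg_left, isInnerProduct_frobSym.sub_right,
    isInnerProduct_frobSym.smul_right] at h2
  refine isInnerProduct_frobSym.eq_zero (not_lt.1 fun hpos => ?_)
  have := mul_pos hε hpos
  linarith

theorem horizonCone_inter_subset_of_closure_barrierCone_sub
    (h : closure (barrierCone frobSym 𝒱) - coneK A = Set.univ) :
    horizonCone 𝒱 ∩ (-polarSet frobSym (coneK A)) ⊆ {0} := by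
  rintro W ⟨hW, hWK⟩
  obtain ⟨b, hb, k, hk, hsub⟩ : W ∈ closure (barrierCone frobSym 𝒱) - coneK A :=
    h ▸ Set.mem_univ W
  simp only at hsub
  have h1 := ip_nonpos_of_mem_horizonCone isInnerProduct_frobSym hW hb
  have h2 := mem_polarSet_coneK.1 hWK k hk
  rw [isInnerProduct_frobSym.neg_left] at h2
  refine isInnerProduct_frobSym.eq_zero ?_
  calc frobSym W W = frobSym W (b - k) := by rw [hsub]
    _ ≤ 0 := by rw [isInnerProduct_frobSym.sub_right]; linarith

theorem horizonCone_inter_subset_of_conjugate_qualification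
    (h : CCQ A (supportFn frobSym 𝒱) ∨
        (barrierCone frobSym 𝒱 ∩ interior (coneK A)).Nonempty ∨
        horizonCone 𝒱 ∩ (-polarSet frobSym (coneK A)) = {0} ∨
        closure (barrierCone frobSym 𝒱) - coneK A = Set.univ) :
    horizonCone 𝒱 ∩ (-polarSet frobSym (coneK A)) ⊆ {0} := by
  rcases h with h | h | h | h
  · exact horizonCone_inter_subset_of_barrierCone_inter_interior
      (h.mono (Set.inter_subset_inter_left _ intrinsicInterior_subset))
  · exact horizonCone_inter_subset_of_barrierCone_inter_interior h
  · exact h.subset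
  · exact horizonCone_inter_subset_of_closure_barrierCone_sub h

theorem convex_section {S : Set (PairSpace n m)} (hS : Convex ℝ S) :
    Convex ℝ {Y | (Y, (0 : SymMat n)) ∈ S} := by
  intro Y hY Z hZ a b ha hb hab
  simpa using hS hY hZ ha hb hab

theorem convex_affine_fiber : Convex ℝ {Y : Matrix (Fin n) (Fin m) ℝ | A * Y = B} := by
  intro Y hY Z hZ a b _ _ hab
  simp only [Set.mem_ofPred_eq] at hY hZ ⊢
  simp [Matrix.mul_add, hY, hZ, ← add_smul, hab]

end MainResult

theorem mainTheorem8 {l n m : ℕ} (hm : 0 < m)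
    (A : Matrix (Fin l) (Fin n) ℝ) (B : Matrix (Fin l) (Fin m) ℝ)
    (hAB : LinearMap.range B.mulVecLin ≤ LinearMap.range A.mulVecLin)
    (𝒱 : Set (SymMat n)) (hne : 𝒱.Nonempty) (hcl : IsClosed 𝒱) (hconv : Convex ℝ 𝒱)
    (h : SymMat n → EReal) (hh : h = supportFn frobSym 𝒱)
    (p : Matrix (Fin n) (Fin m) ℝ → EReal) (hp : p = infProj A B h) :
    -- the two descriptions of `Ξ(A,B)` agree
    setXi A B h = {Y | (Y, (0 : SymMat n)) ∈ setSigma A B 𝒱} ∧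
    -- the conjugate of `p`, in general
    (∀ Y, fenchelConj frob p Y = indicatorFn (closure (setSigma A B 𝒱)) (Y, 0)) ∧
    -- the primal constraint qualifications
    ((PCQ A B h ∨
        posHull (setOmega₂ A B + 𝒱) = (Submodule.span ℝ (setOmega₂ A B + 𝒱) : Set (SymMat n)) ∨
        ((barrierCone frobSym 𝒱 ∩ coneK A).Nonempty ∧
          closure (barrierCone frobSym 𝒱) ∩ coneK A = {0}) ∨
        ((barrierCone frobSym 𝒱 ∩ coneK A).Nonempty ∧
          IsNormBounded frobSym (barrierCone frobSym 𝒱 ∩ coneK A)) ∨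
        ((barrierCone frobSym 𝒱 ∩ coneK A).Nonempty ∧
          horizonCone 𝒱 + polarSet frobSym (coneK A) = Set.univ)) →
      IsClosedProperConvex p ∧ fenchelConj frob (fenchelConj frob p) = p) ∧
    ((PCQ A B h ∨
        posHull (setOmega₂ A B + 𝒱) = (Submodule.span ℝ (setOmega₂ A B + 𝒱) : Set (SymMat n))) →
      (setXi A B h).Nonempty) ∧
    -- the conjugate constraint qualifications
    ((CCQ A h ∨
        (barrierCone frobSym 𝒱 ∩ interior (coneK A)).Nonempty ∨
        horizonCone 𝒱 ∩ (-polarSet frobSym (coneK A)) = {0} ∨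
        closure (barrierCone frobSym 𝒱) - coneK A = Set.univ) →
      IsClosed (setSigma A B 𝒱) ∧
      fenchelConj frob p = indicatorFn (setXi A B h) ∧
      (((setXi A B h).Nonempty ∨ PCQ A B h ∨
          posHull (setOmega₂ A B + 𝒱) =
            (Submodule.span ℝ (setOmega₂ A B + 𝒱) : Set (SymMat n))) →
        IsClosedProperConvex p ∧ fenchelConj frob (fenchelConj frob p) = p ∧
          IsFiniteValued p) ∧
      ((∀ X, p X = ⊥) ∨ (p = supportFn frob (setXi A B h) ∧ IsFiniteValued p)) ∧
      ((p = supportFn frob (setXi A B h) ∧ IsFiniteValued p) ↔ (setXi A B h).Nonempty)) := by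
  subst hh hp
  obtain ⟨Y₀, hY₀⟩ := exists_mul_eq_of_range_le hAB
  have hXi := setXi_eq (A := A) (B := B) hne hcl hconv
  have hp := infProj_eq_infSupp (B := B) hm hY₀ hne
  have hSne := setSigma_nonempty (B := B) hY₀ hne
  have hSconv := convex_setSigma (A := A) (B := B) hconv
  have hXiconv : Convex ℝ (setXi A B (supportFn frobSym 𝒱)) := hXi ▸ convex_section hSconv
  have hconj : ∀ Y, fenchelConj frob (infProj A B (supportFn frobSym 𝒱)) Y =
      indicatorFn (closure (setSigma A B 𝒱)) (Y, 0) := fun Y => by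
    rw [hp]
    exact fenchelConj_infSupp isInnerProduct_frob isInnerProduct_frobSym hSne hSconv Y
  have hXine : (PCQ A B (supportFn frobSym 𝒱) ∨
      posHull (setOmega₂ A B + 𝒱) = (Submodule.span ℝ (setOmega₂ A B + 𝒱) : Set (SymMat n))) →
      (setXi A B (supportFn frobSym 𝒱)).Nonempty := fun h => by
    rw [hXi]
    exact section_nonempty_of_internal hSne hSconv (internal_image_snd_setSigma hne hcl hconv h)
  have hclosed : ∀ T : Set (Matrix (Fin n) (Fin m) ℝ), T.Nonempty → Convex ℝ T →
      infProj A B (supportFn frobSym 𝒱) = supportFn frob T →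
      IsClosedProperConvex (infProj A B (supportFn frobSym 𝒱)) ∧
        fenchelConj frob (fenchelConj frob (infProj A B (supportFn frobSym 𝒱))) =
          infProj A B (supportFn frobSym 𝒱) := fun T hT hTc h => by
    rw [h]
    exact ⟨isClosedProperConvex_supportFn isInnerProduct_frob hT,
      fenchelConj_fenchelConj_supportFn isInnerProduct_frob hT hTc⟩
  refine ⟨hXi, hconj, ?_, hXine, ?_⟩
  · have hprimal : (PCQ A B (supportFn frobSym 𝒱) ∨
        posHull (setOmega₂ A B + 𝒱) = (Submodule.span ℝ (setOmega₂ A B + 𝒱) : Set (SymMat n))) →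
        infProj A B (supportFn frobSym 𝒱) = supportFn frob (setXi A B (supportFn frobSym 𝒱)) :=
      fun h => by
        rw [hp, hXi]
        exact infSupp_eq_supportFn_of_internal isInnerProduct_frob isInnerProduct_frobSym hSne
          hSconv (internal_image_snd_setSigma hne hcl hconv h)
    have htriv : barrierCone frobSym 𝒱 ∩ coneK A ⊆ {0} →
        IsClosedProperConvex (infProj A B (supportFn frobSym 𝒱)) ∧
          fenchelConj frob (fenchelConj frob (infProj A B (supportFn frobSym 𝒱))) =
            infProj A B (supportFn frobSym 𝒱) := fun h =>
      hclosed _ ⟨Y₀, hY₀⟩ convex_affine_fiber (infProj_eq_supportFn_of_trivial hm hY₀ hne h)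
    rintro (h | h | ⟨-, h⟩ | ⟨-, h⟩ | ⟨-, h⟩)
    · exact hclosed _ (hXine (.inl h)) hXiconv (hprimal (.inl h))
    · exact hclosed _ (hXine (.inr h)) hXiconv (hprimal (.inr h))
    · exact htriv ((Set.inter_subset_inter_left _ subset_closure).trans h.subset)
    · exact htriv (barrierCone_inter_coneK_subset_of_isNormBounded h)
    · exact htriv (barrierCone_inter_coneK_subset_of_horizonCone_add h)
  · intro h
    have hhor := horizonCone_inter_subset_of_conjugate_qualification h
    have hSc := isClosed_setSigma (B := B) hcl hhor
    -- The horizon condition is turned back into (1a), whichever condition was assumed, because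
    -- finiteness from above needs an explicit feasible `V₀` in the interior.
    obtain ⟨V₀, hV₀, hV₀K⟩ := barrierCone_inter_interior_nonempty isInnerProduct_frobSym hne hcl
      hconv convex_coneK smul_mem_coneK ⟨_, symOne_mem_interior_coneK⟩ hhor
    have hfin := infSupp_setSigma_lt_top (B := B) hY₀ hV₀ hV₀K
    have hdich : (∀ X, infProj A B (supportFn frobSym 𝒱) X = ⊥) ∨
        ((setXi A B (supportFn frobSym 𝒱)).Nonempty ∧
          infProj A B (supportFn frobSym 𝒱) = supportFn frob (setXi A B (supportFn frobSym 𝒱)) ∧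
          IsFiniteValued (infProj A B (supportFn frobSym 𝒱))) := by
      rw [hXi, hp]
      by_cases hbot : ∃ X, infSupp frob frobSym (setSigma A B 𝒱) X = ⊥
      · obtain ⟨X, hX⟩ := hbot
        exact .inl (infSupp_eq_bot_of_eq_bot isInnerProduct_frob isInnerProduct_frobSym hfin hX)
      · push Not at hbot
        obtain ⟨h1, h2⟩ := infSupp_eq_supportFn_of_finite isInnerProduct_frob
          isInnerProduct_frobSym hSne hSconv hSc hfin hbot
        exact .inr ⟨h1, h2, fun X => ⟨hbot X, (hfin X).ne⟩⟩
    have hiff : (infProj A B (supportFn frobSym 𝒱) =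
        supportFn frob (setXi A B (supportFn frobSym 𝒱)) ∧
          IsFiniteValued (infProj A B (supportFn frobSym 𝒱))) ↔
        (setXi A B (supportFn frobSym 𝒱)).Nonempty := by
      constructor
      · rintro ⟨h1, h2⟩
        by_contra hemp
        rw [Set.not_nonempty_iff_eq_empty] at hemp
        -- The support function of the empty set is `⊥`, which finiteness forbids.
        refine (h2 0).1 ?_
        rw [h1, hemp]
        simp [supportFn]
      · intro hXn
        -- Weak duality excludes `-∞`: the support function of the nonempty set Ξ is never `⊥` and
        -- bounds `p` from below.
        refine (hdich.resolve_left fun hbot => ?_).2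
        refine supportFn_ne_bot (ip := frob) hXn 0 (le_bot_iff.1 ?_)
        rw [← hbot 0, hp, hXi]
        exact supportFn_section_le_infSupp isInnerProduct_frobSym _ _
    refine ⟨hSc, ?_, fun hX => ?_, hdich.imp id And.right, hiff⟩
    · funext Y
      rw [hconj, hSc.closure_eq, hXi]
      rfl
    · have hXn : (setXi A B (supportFn frobSym 𝒱)).Nonempty := hX.elim id hXine
      obtain ⟨h1, h2⟩ := hclosed _ hXn hXiconv (hiff.2 hXn).1
      exact ⟨h1, h2, (hiff.2 hXn).2⟩
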